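/- **Conventions.** Compositions $\alpha=(\alpha_1,\dots,\alpha_k)$ have positive parts; $|\alpha|=\sum_i\alpha_i$, $\ell(\alpha)=k$, and the empty composition is allowed. Put $\mathrm{set}(\alpha)=\{\alpha_1,\alpha_1+\alpha_2,\dots,\alpha_1+\cdots+\alpha_{k-1}\}\subseteq\{1,\dots,|\alpha|-1\}$; let $\mathrm{comp}(S)$ be the composition of $n$ with $\mathrm{set}(\mathrm{comp}(S))=S\subseteq\{1,\dots,n-1\}$, and let $\alpha^c$ be the composition of $|\alpha|$ with $\mathrm{set}(\alpha^c)=\{1,\dots,|\alpha|-1\}\setminus\mathrm{set}(\alpha)$. A composition $\beta$ is a coarsening of $\alpha$ if $|\beta|=|\alpha|$ and $\mathrm{set}(\beta)\subseteq\mathrm{set}(\alpha)$. The diagram of $\alpha$ has $\alpha_i$ left-justified boxes in row $i$, with row $1$ at the bottom. Write $\beta\subseteq\alpha$ if $\ell(\beta)\le\ell(\alpha)$ and $\beta_j\le\alpha_j$ for $1\le j\le\ell(\beta)$. $\mathrm{QSym}$ is the space of quasisymmetric power series of bounded degree over $\mathbb{Q}$ in $x_1,x_2,\dots$, with monomial basis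 $M_\alpha=\sum_{i_1<\cdots<i_k}x_{i_1}^{\alpha_1}\cdots x_{i_k}^{\alpha_k}$ and fundamental basis $F_\alpha=\sum x_{i_1}\cdots x_{i_n}$, where $n=|\alpha|$ and the sum is over $i_1\le\cdots\le i_n$ such that $i_j=i_{j+1}$ implies $j\notin\mathrm{set}(\alpha)$. The linear involution $\psi$ of $\mathrm{QSym}$ is given by $\psi(F_\alpha)=F_{\alpha^c}$. $\mathrm{NSym}$ is the free associative $\mathbb{Q}$-algebra on $\mathbf h_1,\mathbf h_2,\dots$; put $\mathbf h_\alpha=\mathbf h_{\alpha_1}\cdots\mathbf h_{\alpha_k}$ and $\mathbf r_\alpha=\sum_\beta(-1)^{\ell(\alpha)-\ell(\beta)}\mathbf h_\beta$, the sum over all coarsenings $\beta$ of $\alpha$. The bilinear pairing $\langle\cdot,\cdot\rangle:\mathrm{NSym}\times\mathrm{QSym}\to\mathbb{Q}$ is given by $\langle\mathbf h_\alpha,M_\beta\rangle=\delta_{\alpha\beta}$. Let $\mathfrak S^*_\alpha=\sum_T x^T$ (respectively $\mathcal R\mathfrak S^*_\alpha=\sum_T x^T$) be the sum over all fillings $T$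 of the diagram of $\alpha$ with positive integers whose leftmost column strictly (respectively weakly) increases from bottom to top and whose rows weakly (respectively strictly) increase from left to right. Let $\mathfrak S_\beta,\mathcal R\mathfrak S_\beta\in\mathrm{NSym}$ be determined by $\langle\mathfrak S_\beta,\mathfrak S^*_\alpha\rangle=\delta_{\alpha\beta}=\langle\mathcal R\mathfrak S_\beta,\mathcal R\mathfrak S^*_\alpha\rangle$ for all $\alpha$. Let $\mathfrak P$ be the poset of compositions with a labelled cover $\alpha\overset{m}{\to}\beta$ whenever $\beta\subseteq\alpha$, $|\alpha|=|\beta|+1$, $\ell(\alpha)\le\ell(\beta)+1$, and the additional box of $\alpha$ lies in row $m$. For a path $P$: $\alpha=\beta^{(0)}\overset{m_1}{\to}\cdots\overset{m_k}{\to}\beta^{(k)}=\beta$ let $A(P)=\{k-i:1\le i<k,\ m_i\le m_{i+1}\}$. A standard skew immaculate tableau of shape $\alpha/\beta$ is a bijective filling $T$ of the $k$ cells of $\alpha/\beta$ with $1,\dots,k$ whose rows increase from left to right and whose entries in cells lying in the first column of $\alpha$ increase from bottom to top; $\mathrm{Des}_{\mathcal R\mathfrak S^*}(T)$ is the set of all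 $i\in\{1,\dots,k-1\}$ such that $i+1$ lies weakly below $i$ in $T$. Both $\mathrm{comp}(A(P))$ and $\mathrm{comp}(\mathrm{Des}_{\mathcal R\mathfrak S^*}(T))$ are compositions of $k$. **Theorem.** The elements $\mathfrak S_\beta$ and $\mathcal R\mathfrak S_\beta$ of $\mathrm{NSym}$ exist and are unique. Let $\alpha,\beta$ be compositions with $\beta\subseteq\alpha$, and put $$\mathfrak S^*_{\alpha/\beta}=\sum_\gamma\langle\mathfrak S_\beta\mathbf h_\gamma,\mathfrak S^*_\alpha\rangle M_\gamma,\qquad \mathcal R\mathfrak S^*_{\alpha/\beta}=\sum_\gamma\langle\mathcal R\mathfrak S_\beta\mathbf h_\gamma,\mathcal R\mathfrak S^*_\alpha\rangle M_\gamma .$$ Then $$\begin{aligned}\mathcal R\mathfrak S^*_{\alpha/\beta}&=\sum_\gamma\langle\mathcal R\mathfrak S_\beta\mathbf r_\gamma,\mathcal R\mathfrak S^*_\alpha\rangle F_\gamma=\psi(\mathfrak S^*_{\alpha/\beta})=\sum_\gamma\langle\mathcal R\mathfrak S_\beta\,\mathcal R\mathfrak S_\gamma,\mathcal R\mathfrak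 S^*_\alpha\rangle\,\mathcal R\mathfrak S^*_\gamma\\&=\sum_P F_{\mathrm{comp}(A(P))}=\sum_T F_{\mathrm{comp}(\mathrm{Des}_{\mathcal R\mathfrak S^*}(T))},\end{aligned}$$ where $\gamma$ runs over all compositions, $P$ over all paths from $\alpha$ to $\beta$ in $\mathfrak P$, and $T$ over all standard skew immaculate tableaux of shape $\alpha/\beta$. Each of these sums has only finitely many nonzero terms. -/

import Mathlib

namespace RowStrictImmaculate

noncomputable section

/-- Compositions of all sizes `n ≥ 0`, the empty composition included. -/
abbrev Comp : Type := Σ n : ℕ, Composition n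

/-- The size `|α|`. -/
abbrev Comp.size (α : Comp) : ℕ := α.1
/-- The length `ℓ(α)`. -/
abbrev Comp.len (α : Comp) : ℕ := α.2.length
/-- The part of `α` in row `r`, rows being numbered from `0` upwards; it is `0` for `r ≥ ℓ(α)`. -/
def Comp.part (α : Comp) (r : ℕ) : ℕ := α.2.blocks.getD r 0

/-- `set(α) = {α₁, α₁ + α₂, …, α₁ + ⋯ + α_{k-1}}`, a subset of `{1, …, |α| - 1}`. -/
def Comp.descSet (α : Comp) : Finset ℕ :=
  (Finset.Icc 1 (α.2.length - 1)).image α.2.sizeUpTo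

/-- `comp(S) = (s₁, s₂ - s₁, …, n - s_j)`, the composition of `n` attached to a subset
`S = {s₁ < ⋯ < s_j}` of `{1, …, n - 1}`: its boundaries are `0`, `n` and the elements of `S`. -/
def compOf (n : ℕ) (S : Finset ℕ) : Comp :=
  ⟨n, CompositionAsSet.toComposition
    { boundaries := Finset.univ.filter fun i => i = 0 ∨ i = Fin.last n ∨ (i : ℕ) ∈ S
      zero_mem := by simp
      getLast_mem := by simp }⟩

/-- The complement `α^c = comp(set(α)^c)`, where `set(α)^c = {1, …, |α| - 1} \ set(α)`. -/
def Comp.compl (α : Comp) : Comp :=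
  compOf α.size (Finset.Icc 1 (α.size - 1) \ α.descSet)

/-- `β` is a coarsening of `α` (that is, `α` refines `β`): the partial sums of `β` are among those
of `α`. -/
def Comp.Coarsens (β α : Comp) : Prop := β.size = α.size ∧ β.descSet ⊆ α.descSet

/-- The exponent vector of the monomial `∏ j, x_{i j} ^ (a j)`. The variables are `x₀, x₁, …`. -/
def monoExp {k : ℕ} (i : Fin k → ℕ) (a : Fin k → ℕ) : ℕ →₀ ℕ :=
  ∑ j, Finsupp.single (i j) (a j)

/-- `QSym`: power series of bounded degree in `x₀, x₁, …` such that the coefficient of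
`x_{i₁}^{a₁} ⋯ x_{i_k}^{a_k}` is the same for all `i₁ < ⋯ < i_k`, for all positive `a₁, …, a_k`. -/
def QSym : Submodule ℚ (MvPowerSeries ℕ ℚ) where
  carrier := {f |
    (∃ N : ℕ, ∀ d : ℕ →₀ ℕ, N < d.degree → MvPowerSeries.coeff d f = 0) ∧
    ∀ (k : ℕ) (a i : Fin k → ℕ), (∀ j, 0 < a j) → StrictMono i →
      MvPowerSeries.coeff (monoExp i a) f =
        MvPowerSeries.coeff (monoExp (fun j : Fin k => (j : ℕ)) a) f}
  zero_mem' := ⟨⟨0, fun _ _ => by simp⟩, fun _ _ _ _ _ => by simp⟩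
  add_mem' := by
    rintro f g ⟨⟨N, hN⟩, hf⟩ ⟨⟨N', hN'⟩, hg⟩
    refine ⟨⟨max N N', fun d hd => ?_⟩, fun k a i ha hi => ?_⟩
    · rw [map_add, hN d (lt_of_le_of_lt (le_max_left _ _) hd),
        hN' d (lt_of_le_of_lt (le_max_right _ _) hd), add_zero]
    · rw [map_add, map_add, hf k a i ha hi, hg k a i ha hi]
  smul_mem' := by
    rintro c f ⟨⟨N, hN⟩, hf⟩
    refine ⟨⟨N, fun d hd => ?_⟩, fun k a i ha hi => ?_⟩
    · rw [map_smul, hN d hd, smul_zero]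
    · rw [map_smul, map_smul, hf k a i ha hi]

section Fillings
variable {ι : Type} [Fintype ι]

/-- The exponent vector of `∏ c, x_{T c} ^ (w c)`. -/
def content (w : ι → ℕ) (T : ι → ℕ) : ℕ →₀ ℕ := ∑ c, Finsupp.single (T c) (w c)

/-- The generating function `∑_T ∏ c, x_{T c} ^ (w c)` over all `T : ι → ℕ` that satisfy `P`. For
positive weights only finitely many `T` contribute to a given monomial. -/
def genFun (w : ι → ℕ) (P : (ι → ℕ) → Prop) : MvPowerSeries ℕ ℚ :=
  fun d => (Nat.card {T : ι → ℕ // P T ∧ content w T = d} : ℚ)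

theorem coeff_genFun (w : ι → ℕ) (P : (ι → ℕ) → Prop) (d : ℕ →₀ ℕ) :
    MvPowerSeries.coeff d (genFun w P) =
      (Nat.card {T : ι → ℕ // P T ∧ content w T = d} : ℚ) := rfl

theorem content_degree (w T : ι → ℕ) : (content w T).degree = ∑ c, w c := by
  simp [content, map_sum]

theorem content_comp (w : ι → ℕ) {k : ℕ} (i : Fin k → ℕ) (T : ι → Fin k) :
    content w (i ∘ T) = Finsupp.mapDomain i (∑ c, Finsupp.single (T c) (w c)) := by
  simp [content, Finsupp.mapDomain_finsetSum, Finsupp.mapDomain_single]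

theorem monoExp_eq {k : ℕ} (i a : Fin k → ℕ) :
    monoExp i a = Finsupp.mapDomain i (∑ c, Finsupp.single c (a c)) := by
  simp [monoExp, Finsupp.mapDomain_finsetSum, Finsupp.mapDomain_single]

theorem mem_support_content (w : ι → ℕ) (hw : ∀ c, 0 < w c) (T : ι → ℕ) (x : ℕ) :
    x ∈ (content w T).support ↔ ∃ c, T c = x := by
  rw [Finsupp.mem_support_iff, content, Finsupp.finsetSum_apply]
  simp only [ne_eq, Finset.sum_eq_zero_iff, Finset.mem_univ, true_implies, not_forall]
  refine exists_congr fun c => ?_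
  by_cases h : T c = x
  · simp [h, (hw c).ne']
  · simp [h]

theorem card_fillings (w : ι → ℕ) (hw : ∀ c, 0 < w c) (P : (ι → ℕ) → Prop)
    (hP : ∀ T T' : ι → ℕ, (∀ c c', T c < T c' ↔ T' c < T' c') → P T → P T')
    {k : ℕ} (a i : Fin k → ℕ) (hi : StrictMono i) :
    Nat.card {T : ι → ℕ // P T ∧ content w T = monoExp i a} =
      Nat.card {T : ι → Fin k // P (fun c => (T c : ℕ)) ∧
        ∑ c, Finsupp.single (T c) (w c) = ∑ c, Finsupp.single c (a c)} := by
  symm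
  refine Nat.card_congr (Equiv.ofBijective
    (fun T => ⟨i ∘ T.1, hP _ _ (fun c c' => ?_) T.2.1, ?_⟩) ⟨?_, ?_⟩)
  · simp [hi.lt_iff_lt]
  · rw [content_comp, T.2.2, monoExp_eq]
  · intro T T' h
    apply Subtype.ext
    funext c
    exact hi.injective (congrFun (congrArg Subtype.val h) c)
  · rintro ⟨T, hT, hc⟩
    have hr : ∀ c, ∃ j, i j = T c := by
      intro c
      have h1 : T c ∈ (content w T).support := (mem_support_content w hw T _).2 ⟨c, rfl⟩
      rw [hc, monoExp_eq] at h1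
      have h2 := Finsupp.mapDomain_support h1
      obtain ⟨j, -, hj⟩ := Finset.mem_image.1 h2
      exact ⟨j, hj⟩
    choose T' hT' using hr
    have hTT : i ∘ T' = T := funext hT'
    refine ⟨⟨T', hP T _ (fun c c' => ?_) hT, ?_⟩, Subtype.ext hTT⟩
    · rw [← hT' c, ← hT' c', hi.lt_iff_lt, Fin.lt_def]
    · apply Finsupp.mapDomain_injective hi.injective
      rw [← content_comp, hTT, hc, monoExp_eq]

theorem genFun_mem_QSym (w : ι → ℕ) (hw : ∀ c, 0 < w c) (P : (ι → ℕ) → Prop)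
    (hP : ∀ T T' : ι → ℕ, (∀ c c', T c < T c' ↔ T' c < T' c') → P T → P T') :
    genFun w P ∈ QSym := by
  refine ⟨⟨∑ c, w c, fun d hd => ?_⟩, fun k a i _ hi => ?_⟩
  · rw [coeff_genFun]
    have : IsEmpty {T : ι → ℕ // P T ∧ content w T = d} :=
      ⟨fun T => by have := content_degree w T.1; rw [T.2.2] at this; omega⟩
    simp
  · rw [coeff_genFun, coeff_genFun, card_fillings w hw P hP a i hi,
      card_fillings w hw P hP a _ (fun _ _ h => h)]

end Fillings

/-- The monomial quasisymmetric function `M_α = ∑_{i₁ < ⋯ < i_k} x_{i₁}^{α₁} ⋯ x_{i_k}^{α_k}`. -/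
def M (α : Comp) : QSym :=
  ⟨genFun α.2.blocksFun StrictMono,
    genFun_mem_QSym _ (fun j => α.2.one_le_blocksFun j) _
      fun _ _ h hT _ _ hcc => (h _ _).1 (hT hcc)⟩

/-- `i₁ ≤ ⋯ ≤ i_n`, and `i_j = i_{j+1}` only if `j ∉ set(α)`. (In the code the positions are
counted from `0`, so `b` is the position `j + 1` and its value is `j`.) -/
def IsFundamentalIndex (α : Comp) (i : Fin α.size → ℕ) : Prop :=
  Monotone i ∧ ∀ a b : Fin α.size, (b : ℕ) = a + 1 → i a = i b → (b : ℕ) ∉ α.descSet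

/-- The fundamental quasisymmetric function `F_α`. -/
def F (α : Comp) : QSym :=
  ⟨genFun (fun _ => 1) (IsFundamentalIndex α),
    genFun_mem_QSym _ (fun _ => Nat.one_pos) _ fun T T' h hT => by
      refine ⟨fun a b hab => ?_, fun a b hab he => hT.2 a b hab ?_⟩
      · have h1 := hT.1 hab
        have h2 := h b a
        omega
      · have h1 := h a b
        have h2 := h b a
        omega⟩

/-- The diagram of `α`: cells are pairs (row, column), both counted from `0`, with row `0` the
bottom row. -/
def diagram (α : Comp) : Finset (ℕ × ℕ) :=
  (Finset.range α.len ×ˢ Finset.range α.size).filter fun p => p.2 < α.part p.1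

theorem mem_diagram (α : Comp) (p : ℕ × ℕ) : p ∈ diagram α ↔ p.2 < α.part p.1 := by
  rw [diagram, Finset.mem_filter, Finset.mem_product, Finset.mem_range, Finset.mem_range]
  refine ⟨fun h => h.2, fun h => ⟨?_, h⟩⟩
  have hl : p.1 < α.2.blocks.length := by
    by_contra hl
    rw [Comp.part, List.getD_eq_default _ _ (not_lt.1 hl)] at h
    exact absurd h (Nat.not_lt_zero _)
  refine ⟨hl, lt_of_lt_of_le h ?_⟩
  rw [Comp.part, List.getD_eq_getElem _ _ hl]
  exact α.2.blocks_le (List.getElem_mem hl)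

/-- The exponent vector of `x₀^{c₁} x₁^{c₂} ⋯`. -/
def expo (c : Comp) : ℕ →₀ ℕ := monoExp (fun j : Fin c.2.length => (j : ℕ)) c.2.blocksFun

/-- The coefficient of `x₀^{c₁} x₁^{c₂} ⋯`. -/
def coeffAt (c : Comp) : QSym →ₗ[ℚ] ℚ := (MvPowerSeries.coeff (expo c)).comp QSym.subtype

theorem expo_degree (c : Comp) : (expo c).degree = c.size := by
  simp [expo, monoExp, map_sum]

theorem exists_expo {k : ℕ} (a : Fin k → ℕ) (ha : ∀ j, 0 < a j) :
    ∃ c : Comp, expo c = monoExp (fun j : Fin k => (j : ℕ)) a := by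
  refine ⟨⟨(List.ofFn a).sum, ⟨List.ofFn a, ?_, rfl⟩⟩, ?_⟩
  · intro x hx
    obtain ⟨j, rfl⟩ := (List.mem_ofFn' _ _).1 hx
    exact ha j
  · rw [expo, monoExp, monoExp]
    refine Fintype.sum_equiv (finCongr (List.length_ofFn)) _ _ fun j => ?_
    simp [Composition.blocksFun]
    rfl

theorem qsym_ext {f g : QSym} (h : ∀ c, coeffAt c f = coeffAt c g) : f = g := by
  apply Subtype.ext
  apply MvPowerSeries.ext
  intro d
  have hd : d = monoExp (d.support.orderEmbOfFin rfl)
      (fun j => d (d.support.orderEmbOfFin rfl j)) := by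
    rw [monoExp]
    conv_lhs => rw [← Finsupp.sum_single d, Finsupp.sum]
    rw [← Finset.sum_image (s := Finset.univ) (g := d.support.orderEmbOfFin rfl)
      (f := fun x => Finsupp.single x (d x))]
    · rw [Finset.image_orderEmbOfFin_univ]
    · exact fun x _ y _ hxy => (d.support.orderEmbOfFin rfl).injective hxy
  have hpos : ∀ j, 0 < d (d.support.orderEmbOfFin rfl j) := fun j =>
    Nat.pos_of_ne_zero (Finsupp.mem_support_iff.1 (Finset.orderEmbOfFin_mem _ rfl j))
  rw [hd, f.2.2 _ _ _ hpos (d.support.orderEmbOfFin rfl).strictMono,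
    g.2.2 _ _ _ hpos (d.support.orderEmbOfFin rfl).strictMono]
  obtain ⟨c, hc⟩ := exists_expo _ hpos
  rw [← hc]
  exact h c

theorem coeffAt_M (γ c : Comp) : coeffAt c (M γ) = if γ = c then 1 else 0 := by
  have key : ∀ T : Fin γ.2.length → ℕ, StrictMono T → content γ.2.blocksFun T = expo c →
      γ = c ∧ T = fun j : Fin γ.2.length => (j : ℕ) := by
    intro T hT h
    have hs : ∀ x, (∃ j, T j = x) ↔ x < c.2.length := by
      intro x
      rw [← mem_support_content γ.2.blocksFun (fun j => γ.2.one_le_blocksFun j), h]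
      change x ∈ (content c.2.blocksFun fun j => (j : ℕ)).support ↔ _
      rw [mem_support_content _ (fun j => c.2.one_le_blocksFun j)]
      exact ⟨fun ⟨j, hj⟩ => hj ▸ j.2, fun hx => ⟨⟨x, hx⟩, rfl⟩⟩
    have hcard : γ.2.length = c.2.length := by
      have h1 : Finset.univ.image T = Finset.range c.2.length := by
        ext x; simp only [Finset.mem_image, Finset.mem_univ, true_and, Finset.mem_range, hs]
      have h2 := Finset.card_image_of_injective Finset.univ hT.injective
      rw [h1] at h2
      simpa using h2.symm
    have hid : T = fun j : Fin γ.2.length => (j : ℕ) := by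
      refine (StrictMono.range_inj hT (fun _ _ h => h)).1 ?_
      ext x
      rw [Set.mem_range, hs, ← hcard]
      exact ⟨fun hx => ⟨⟨x, hx⟩, rfl⟩, fun ⟨j, hj⟩ => hj ▸ j.2⟩
    refine ⟨?_, hid⟩
    rw [Composition.sigma_eq_iff_blocks_eq]
    refine List.ext_get hcard fun m h1 h2 => ?_
    have h3 := DFunLike.congr_fun h m
    rw [hid] at h3
    have e : ∀ (n : ℕ) (b : Fin n → ℕ) (hm : m < n),
        (∑ j : Fin n, Finsupp.single (j : ℕ) (b j)) m = b ⟨m, hm⟩ := by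
      intro n b hm
      rw [Finsupp.finsetSum_apply, Finset.sum_eq_single ⟨m, hm⟩]
      · simp
      · intro j _ hj
        exact Finsupp.single_eq_of_ne' (fun hh => hj (Fin.ext hh))
      · simp
    have h4 : γ.2.blocksFun ⟨m, h1⟩ = c.2.blocksFun ⟨m, h2⟩ := by
      rw [← e _ γ.2.blocksFun h1, ← e _ c.2.blocksFun h2]
      exact h3
    exact h4
  change ((Nat.card {T : Fin γ.2.length → ℕ // StrictMono T ∧
    content γ.2.blocksFun T = expo c} : ℕ) : ℚ) = _
  split_ifs with h
  · subst h
    have : Unique {T : Fin γ.2.length → ℕ // StrictMono T ∧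
        content γ.2.blocksFun T = expo γ} :=
      { default := ⟨fun j => (j : ℕ), fun _ _ h => h, rfl⟩
        uniq := fun T => Subtype.ext (key T.1 T.2.1 T.2.2).2 }
    simp
  · have : IsEmpty {T : Fin γ.2.length → ℕ // StrictMono T ∧
        content γ.2.blocksFun T = expo c} := ⟨fun T => h (key T.1 T.2.1 T.2.2).1⟩
    simp

theorem index_mono {n : ℕ} (c : Composition n) {x y : Fin n} (h : x ≤ y) :
    c.index x ≤ c.index y := by
  by_contra hlt
  rw [not_le] at hlt
  have h1 := c.sizeUpTo_index_le x
  have h2 := c.lt_sizeUpTo_index_succ y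
  have h3 : c.sizeUpTo (c.index y).succ ≤ c.sizeUpTo (c.index x) :=
    c.monotone_sizeUpTo (by simpa using hlt)
  have h4 : (x : ℕ) ≤ y := h
  omega

theorem index_eq_iff {c : Comp} {a b : Fin c.size} (hab : (b : ℕ) = a + 1) :
    c.2.index a = c.2.index b ↔ (b : ℕ) ∉ c.descSet := by
  have ha1 := c.2.sizeUpTo_index_le a
  have ha2 := c.2.lt_sizeUpTo_index_succ a
  have hb1 := c.2.sizeUpTo_index_le b
  have hb2 := c.2.lt_sizeUpTo_index_succ b
  rw [Comp.descSet, Finset.mem_image]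
  constructor
  · rintro h ⟨r, hr, hrb⟩
    rw [Finset.mem_Icc] at hr
    rw [Fin.val_succ] at *
    have h1 : r ≤ c.2.index b := by
      by_contra hh
      have := c.2.monotone_sizeUpTo (show (c.2.index b : ℕ) + 1 ≤ r by omega)
      omega
    have h2 := c.2.monotone_sizeUpTo h1
    rw [h] at ha1
    omega
  · intro h
    by_contra hne
    have hlt : c.2.index a < c.2.index b :=
      lt_of_le_of_ne (index_mono _ (by rw [Fin.le_def]; omega)) hne
    rw [Fin.val_succ] at *
    have h1 := c.2.monotone_sizeUpTo (show (c.2.index a : ℕ) + 1 ≤ c.2.index b from hlt)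
    refine h ⟨c.2.index b, ?_, by omega⟩
    rw [Finset.mem_Icc]
    have := (c.2.index b).2
    rw [Fin.lt_def] at hlt
    omega

theorem content_index (c : Comp) :
    content (fun _ => 1) (fun j : Fin c.size => (c.2.index j : ℕ)) = expo c := by
  rw [content, expo, monoExp, ← c.2.blocksFinEquiv.sum_comp, Fintype.sum_sigma]
  refine Finset.sum_congr rfl fun r _ => ?_
  have : ∀ y : Fin (c.2.blocksFun r), c.2.index (c.2.blocksFinEquiv ⟨r, y⟩) = r :=
    fun y => c.2.index_embedding r y
  simp [this]

theorem monotone_eq_of_content {n : ℕ} {T T' : Fin n → ℕ} (h : Monotone T) (h' : Monotone T')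
    (hc : content (fun _ => 1) T = content (fun _ => 1) T') : T = T' := by
  have e : ∀ S : Fin n → ℕ, content (fun _ => 1) S =
      Multiset.toFinsupp ((List.ofFn S : List ℕ) : Multiset ℕ) := by
    intro S
    ext x
    rw [Multiset.toFinsupp_apply, ← Fin.univ_val_map, Multiset.count_map, content,
      Finsupp.finsetSum_apply]
    simp only [Finsupp.single_apply, Finset.sum_boole, Nat.cast_id, eq_comm (a := x)]
    rfl
  rw [e, e] at hc
  have hp := Multiset.coe_eq_coe.1 (Multiset.toFinsupp.injective hc)
  exact List.ofFn_injective (hp.eq_of_sortedLE h.sortedLE_ofFn h'.sortedLE_ofFn)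

open scoped Classical in
theorem coeffAt_F (γ c : Comp) : coeffAt c (F γ) = if Comp.Coarsens γ c then 1 else 0 := by
  obtain ⟨n, γ⟩ := γ
  change ((Nat.card {T : Fin n → ℕ // IsFundamentalIndex ⟨n, γ⟩ T ∧
    content (fun _ => 1) T = expo c} : ℕ) : ℚ) = _
  by_cases hn : n = c.size
  · obtain ⟨m, c⟩ := c
    obtain rfl : n = m := hn
    have key : ∀ T : Fin n → ℕ, Monotone T → content (fun _ => 1) T = expo ⟨n, c⟩ →
        T = fun j => (c.index j : ℕ) := fun T hT h =>
      monotone_eq_of_content hT (fun _ _ hxy => index_mono _ hxy)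
        (h.trans (content_index ⟨n, c⟩).symm)
    have hD : IsFundamentalIndex ⟨n, γ⟩ (fun j => (c.index j : ℕ)) ↔
        Comp.Coarsens ⟨n, γ⟩ ⟨n, c⟩ := by
      constructor
      · refine fun h => ⟨rfl, fun s hs => ?_⟩
        by_contra hsc
        have hs' := hs
        rw [Comp.descSet, Finset.mem_image] at hs'
        obtain ⟨r, hr, hrs⟩ := hs'
        rw [Finset.mem_Icc] at hr
        dsimp only at hr hrs
        have hr0 : 0 < s := by
          have h1 := γ.sizeUpTo_strict_mono (i := 0) (by omega)
          have h2 := γ.monotone_sizeUpTo (show 0 + 1 ≤ r from hr.1)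
          omega
        have hrn : s < n := by
          have h1 := γ.sizeUpTo_strict_mono (i := r) (by omega)
          have h2 := γ.sizeUpTo_le (r + 1)
          omega
        have h3 := (index_eq_iff (c := ⟨n, c⟩) (a := ⟨s - 1, show s - 1 < n by omega⟩) (b := ⟨s, hrn⟩)
          (by dsimp only; omega)).2 hsc
        exact h.2 ⟨s - 1, show s - 1 < n by omega⟩ ⟨s, hrn⟩ (by dsimp only; omega)
          (congrArg Fin.val h3) hs
      · refine fun h => ⟨fun _ _ hxy => index_mono _ hxy, fun a b hab he hb => ?_⟩
        exact (index_eq_iff (c := ⟨n, c⟩) hab).1 (Fin.ext he) (h.2 hb)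
    split_ifs with h
    · have : Unique {T : Fin n → ℕ // IsFundamentalIndex ⟨n, γ⟩ T ∧
          content (fun _ => 1) T = expo ⟨n, c⟩} :=
        { default := ⟨fun j => (c.index j : ℕ), hD.2 h, content_index ⟨n, c⟩⟩
          uniq := fun T => Subtype.ext (key T.1 T.2.1.1 T.2.2) }
      simp
    · have : IsEmpty {T : Fin n → ℕ // IsFundamentalIndex ⟨n, γ⟩ T ∧
          content (fun _ => 1) T = expo ⟨n, c⟩} :=
        ⟨fun T => h (hD.1 (key T.1 T.2.1.1 T.2.2 ▸ T.2.1))⟩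
      simp
  · rw [if_neg (fun h => hn h.1)]
    have : IsEmpty {T : Fin n → ℕ // IsFundamentalIndex ⟨n, γ⟩ T ∧
        content (fun _ => 1) T = expo c} :=
      ⟨fun T => hn (by
        have h1 := congrArg Finsupp.degree T.2.2
        rw [content_degree, expo_degree] at h1
        simpa using h1)⟩
    simp

theorem mem_boundaries_iff (c : Comp) (x : Fin (c.size + 1)) :
    x ∈ c.2.boundaries ↔ x = 0 ∨ x = Fin.last c.size ∨ (x : ℕ) ∈ c.descSet := by
  rw [Composition.boundaries, Finset.mem_map, Comp.descSet, Finset.mem_image]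
  simp only [Finset.mem_univ, true_and, Finset.mem_Icc, Fin.ext_iff]
  change (∃ a : Fin (c.2.length + 1), c.2.sizeUpTo a = x) ↔ _
  constructor
  · rintro ⟨a, ha⟩
    by_cases h0 : (a : ℕ) = 0
    · left; rw [← ha, h0]; simp
    · by_cases h1 : (a : ℕ) = c.2.length
      · right; left; rw [← ha, h1]; simp
      · right; right; exact ⟨a, by omega, ha⟩
  · rintro (h | h | ⟨r, hr, h⟩)
    · exact ⟨0, by rw [h]; simp⟩
    · exact ⟨Fin.last _, by rw [h]; simp⟩
    · exact ⟨⟨r, by omega⟩, h⟩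

theorem compOf_descSet (c : Comp) : compOf c.size c.descSet = c := by
  obtain ⟨n, c⟩ := c
  have h : (CompositionAsSet.toComposition
      { boundaries := Finset.univ.filter fun i : Fin (n + 1) => i = 0 ∨ i = Fin.last n ∨
          (i : ℕ) ∈ Comp.descSet ⟨n, c⟩
        zero_mem := by simp
        getLast_mem := by simp }) = c := by
    apply (compositionEquiv n).injective
    change (CompositionAsSet.toComposition _).toCompositionAsSet = c.toCompositionAsSet
    apply CompositionAsSet.ext
    change (CompositionAsSet.toComposition _).boundaries = c.boundaries
    rw [CompositionAsSet.toComposition_boundaries]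
    ext x
    rw [mem_boundaries_iff ⟨n, c⟩]
    simp
  exact congrArg (Sigma.mk n) h

theorem Coarsens.eq_of_card_le {β α : Comp} (h : Comp.Coarsens β α)
    (hc : α.descSet.card ≤ β.descSet.card) : β = α := by
  rw [← compOf_descSet β, ← compOf_descSet α, h.1, Finset.eq_of_subset_of_card_le h.2 hc]

open scoped Classical in
theorem F_eq_sum_M (γ : Comp) : F γ =
    ∑ δ : Composition γ.size, if Comp.Coarsens γ ⟨γ.size, δ⟩ then M ⟨γ.size, δ⟩ else 0 := by
  refine qsym_ext fun c => ?_
  rw [coeffAt_F, map_sum]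
  by_cases hs : c.size = γ.size
  · obtain ⟨m, c⟩ := c
    obtain rfl : m = γ.size := hs
    rw [Finset.sum_eq_single c]
    · split_ifs with h
      · rw [coeffAt_M, if_pos rfl]
      · simp
    · intro δ _ hδ
      split_ifs
      · rw [coeffAt_M, if_neg]
        intro h
        exact hδ (eq_of_heq (Sigma.mk.inj h).2)
      · simp
    · simp
  · rw [if_neg (fun h => hs h.1.symm), Finset.sum_eq_zero]
    intro δ _
    split_ifs
    · rw [coeffAt_M, if_neg]
      rintro rfl
      exact hs rfl
    · simp

theorem card_descSet_le (c : Comp) : c.descSet.card ≤ c.size := by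
  refine Finset.card_image_le.trans ?_
  have := c.2.length_le
  simp only [Nat.card_Icc]
  exact le_trans (by omega) this

theorem M_mem_span (γ : Comp) : M γ ∈ Submodule.span ℚ (Set.range F) := by
  classical
  induction hk : γ.size - γ.descSet.card using Nat.strong_induction_on generalizing γ with
  | _ k ih =>
    have h1 := F_eq_sum_M γ
    rw [← Finset.add_sum_erase _ _ (Finset.mem_univ γ.2),
      if_pos (show Comp.Coarsens γ ⟨γ.size, γ.2⟩ from ⟨rfl, subset_rfl⟩)] at h1
    rw [show M γ = F γ - _ from eq_sub_of_add_eq h1.symm]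
    refine Submodule.sub_mem _ (Submodule.subset_span ⟨γ, rfl⟩) (Submodule.sum_mem _ ?_)
    intro δ hδ
    split_ifs with h
    · refine ih _ ?_ ⟨γ.size, δ⟩ rfl
      have h2 : γ.descSet.card < (Comp.descSet ⟨γ.size, δ⟩).card := by
        by_contra hlt
        have h3 := Coarsens.eq_of_card_le h (not_lt.1 hlt)
        refine (Finset.mem_erase.1 hδ).1 ?_
        exact (eq_of_heq (Sigma.mk.inj (h3 : (⟨γ.1, γ.2⟩ : Comp) = ⟨γ.1, δ⟩)).2).symm
      have h4 := card_descSet_le ⟨γ.size, δ⟩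
      change γ.size - _ < k
      dsimp only [Comp.size] at *
      omega
    · exact Submodule.zero_mem _

theorem F_span : ⊤ ≤ Submodule.span ℚ (Set.range F) := by
  intro f _
  obtain ⟨N, hN⟩ := f.2.1
  have hf : f = ∑ n ∈ Finset.range (N + 1), ∑ γ : Composition n,
      coeffAt ⟨n, γ⟩ f • M ⟨n, γ⟩ := by
    refine qsym_ext fun c => ?_
    simp only [map_sum, map_smul, coeffAt_M, smul_eq_mul]
    by_cases hc : c.size ≤ N
    · rw [Finset.sum_eq_single c.size, Finset.sum_eq_single c.2]
      · simp
      · intro δ _ hδ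
        rw [if_neg, mul_zero]
        intro h
        exact hδ (eq_of_heq (Sigma.mk.inj (h : (⟨c.1, δ⟩ : Comp) = ⟨c.1, c.2⟩)).2)
      · simp
      · intro n _ hn
        refine Finset.sum_eq_zero fun δ _ => ?_
        rw [if_neg, mul_zero]
        rintro rfl
        exact hn rfl
      · intro h
        exact absurd (Finset.mem_range.2 (Nat.lt_succ_of_le hc)) h
    · have h0 : coeffAt c f = 0 := hN _ (by rw [expo_degree]; omega)
      rw [h0]
      symm
      refine Finset.sum_eq_zero fun n _ => Finset.sum_eq_zero fun δ _ => ?_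
      split_ifs with h
      · rw [h, h0, zero_mul]
      · rw [mul_zero]
  rw [hf]
  exact Submodule.sum_mem _ fun n _ => Submodule.sum_mem _ fun γ _ =>
    Submodule.smul_mem _ _ (M_mem_span _)

theorem F_linearIndependent : LinearIndependent ℚ F := by
  classical
  rw [linearIndependent_iff]
  intro l hl
  by_contra hne
  obtain ⟨γ, hγ, hmin⟩ := Finset.exists_min_image l.support (fun c => c.descSet.card)
    (Finsupp.support_nonempty_iff.2 hne)
  have h := congrArg (coeffAt γ) hl
  rw [Finsupp.linearCombination_apply, Finsupp.sum, map_sum, map_zero,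
    Finset.sum_eq_single γ] at h
  · rw [map_smul, coeffAt_F, if_pos ⟨rfl, subset_rfl⟩, smul_eq_mul, mul_one] at h
    exact Finsupp.mem_support_iff.1 hγ h
  · intro α hα hαγ
    rw [map_smul, coeffAt_F, if_neg, smul_zero]
    exact fun hc => hαγ (Coarsens.eq_of_card_le hc (hmin α hα))
  · exact fun h => absurd hγ h

/-- The fundamental quasisymmetric functions as a basis of `QSym`. -/
def fundamentalBasis : Module.Basis Comp ℚ QSym :=
  Module.Basis.mk F_linearIndependent F_span

/-- The linear involution `ψ` of `QSym`, given on the fundamental basis by `ψ(F_α) = F_{α^c}`. -/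
def psi : QSym →ₗ[ℚ] QSym := fundamentalBasis.constr ℚ fun α => F α.compl

theorem psi_F (α : Comp) : psi (F α) = F α.compl := by
  rw [← Module.Basis.constr_basis fundamentalBasis ℚ (fun α => F α.compl) α, psi,
    fundamentalBasis, Module.Basis.mk_apply]

/-! ### Noncommutative symmetric functions -/

/-- `NSym`, the free associative algebra on the complete homogeneous generators
`h₁, h₂, h₃, …`. -/
abbrev NSym : Type := FreeAlgebra ℚ ℕ+

/-- The generator `h_n`, with `h_0 = 1`. -/
def hGen (n : ℕ) : NSym := if hn : 0 < n then FreeAlgebra.ι ℚ (⟨n, hn⟩ : ℕ+) else 1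

/-- The complete homogeneous function `h_α = h_{α₁} ⋯ h_{α_k}`. -/
def h (α : Comp) : NSym := (α.2.blocks.map hGen).prod

open scoped Classical in
/-- The noncommutative ribbon function `R_α = ∑_β (-1)^{ℓ(α) - ℓ(β)} h_β`, over the
coarsenings `β` of `α`. -/
def ribbon (α : Comp) : NSym :=
  ∑ β : Composition α.size, if Comp.Coarsens ⟨α.size, β⟩ α then
    (-1 : ℚ) ^ (α.len - β.length) • h ⟨α.size, β⟩ else 0

/-- The composition whose parts are the letters of a word. -/
def wordComp (w : FreeMonoid ℕ+) : Comp :=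
  ⟨((FreeMonoid.toList w).map fun a : ℕ+ => (a : ℕ)).sum,
    { blocks := (FreeMonoid.toList w).map fun a : ℕ+ => (a : ℕ)
      blocks_pos := by
        intro i hi
        obtain ⟨a, -, rfl⟩ := List.mem_map.1 hi
        exact a.pos
      blocks_sum := rfl }⟩

/-- The bilinear pairing of `NSym` with `QSym` for which `⟨h_α, f⟩` is the coefficient of
`x₀^{α₁} x₁^{α₂} ⋯` in `f`, which is the coefficient of `M_α`; see `pairing_h_M`. The words in the
generators `h_n` are a basis of `NSym`. -/
def pairing : NSym →ₗ[ℚ] QSym →ₗ[ℚ] ℚ :=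
  (FreeAlgebra.basisFreeMonoid ℚ ℕ+).constr ℚ fun w => coeffAt (wordComp w)

theorem h_wordComp (w : FreeMonoid ℕ+) :
    h (wordComp w) = FreeAlgebra.basisFreeMonoid ℚ ℕ+ w := by
  induction w using FreeMonoid.recOn with
  | one =>
    simp only [h, wordComp, FreeMonoid.toList_one, List.map_nil, List.prod_nil]
    exact (map_one (FreeAlgebra.equivMonoidAlgebraFreeMonoid (R := ℚ) (X := ℕ+)).symm).symm
  | of_mul a w ih =>
    have e1 : h (wordComp (FreeMonoid.of a * w)) = FreeAlgebra.ι ℚ a * h (wordComp w) := by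
      have ha : hGen (a : ℕ) = FreeAlgebra.ι ℚ a := dif_pos a.pos
      simp only [h, wordComp, FreeMonoid.toList_mul, FreeMonoid.toList_of, List.map_append,
        List.map_cons, List.map_nil, List.prod_append, List.prod_singleton, ha]
    rw [e1, ih]
    simp [FreeAlgebra.basisFreeMonoid, FreeAlgebra.equivMonoidAlgebraFreeMonoid]

theorem pairing_h (α : Comp) : pairing (h α) = coeffAt α := by
  obtain ⟨w, rfl⟩ : ∃ w, wordComp w = α := by
    refine ⟨FreeMonoid.ofList (α.2.blocks.map Nat.toPNat'), ?_⟩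
    rw [Composition.sigma_eq_iff_blocks_eq]
    have : ∀ l : List ℕ, (∀ i ∈ l, 0 < i) →
        (l.map Nat.toPNat').map (fun a : ℕ+ => (a : ℕ)) = l := by
      intro l hl
      rw [List.map_map]
      conv_rhs => rw [← List.map_id l]
      refine List.map_congr_left fun i hi => ?_
      simp [hl i hi]
    exact this _ fun i hi => α.2.blocks_pos hi
  rw [h_wordComp, pairing, Module.Basis.constr_basis]

theorem pairing_h_M (α β : Comp) : pairing (h α) (M β) = if α = β then 1 else 0 := by
  rw [pairing_h, coeffAt_M]
  simp only [eq_comm]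

/-! ### Dual immaculate functions and their row-strict analogues -/

/-- Immaculate tableaux of shape `α`: the leftmost column strictly increases from bottom to top
and the rows weakly increase from left to right. -/
def IsImmaculate (α : Comp) (T : diagram α → ℕ) : Prop :=
  (∀ p q : diagram α, p.1.2 = 0 → q.1.2 = 0 → p.1.1 < q.1.1 → T p < T q) ∧
  (∀ p q : diagram α, p.1.1 = q.1.1 → p.1.2 < q.1.2 → T p ≤ T q)

/-- Row-strict immaculate tableaux of shape `α`: the leftmost column weakly increases from bottom
to top and the rows strictly increase from left to right. -/
def IsRowStrictImmaculate (α : Comp) (T : diagram α → ℕ) : Prop :=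
  (∀ p q : diagram α, p.1.2 = 0 → q.1.2 = 0 → p.1.1 < q.1.1 → T p ≤ T q) ∧
  (∀ p q : diagram α, p.1.1 = q.1.1 → p.1.2 < q.1.2 → T p < T q)

/-- The dual immaculate function `𝔖*_α`, the sum of `x^T` over all immaculate tableaux `T` of
shape `α`. -/
def dualImmaculate (α : Comp) : QSym :=
  ⟨genFun (fun _ => 1) (IsImmaculate α),
    genFun_mem_QSym _ (fun _ => Nat.one_pos) _ fun T T' e hT => by
      refine ⟨fun p q hp hq hpq => (e p q).1 (hT.1 p q hp hq hpq), fun p q hp hpq => ?_⟩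
      have h1 := hT.2 p q hp hpq
      have h2 := e q p
      omega⟩

/-- The row-strict dual immaculate function `ℛ𝔖*_α`, the sum of `x^T` over all row-strict
immaculate tableaux `T` of shape `α`. -/
def rsDualImmaculate (α : Comp) : QSym :=
  ⟨genFun (fun _ => 1) (IsRowStrictImmaculate α),
    genFun_mem_QSym _ (fun _ => Nat.one_pos) _ fun T T' e hT => by
      refine ⟨fun p q hp hq hpq => ?_, fun p q hp hpq => (e p q).1 (hT.2 p q hp hpq)⟩
      have h1 := hT.1 p q hp hq hpq
      have h2 := e q p
      omega⟩

/-- `g` is the member with index `β` of the family in `NSym` dual to the family `B` in `QSym`: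
`⟨g, B_α⟩ = δ_{αβ}` for all compositions `α`. -/
def IsDualTo (B : Comp → QSym) (β : Comp) (g : NSym) : Prop :=
  ∀ α : Comp, pairing g (B α) = if α = β then 1 else 0

/-- The immaculate function `𝔖_β`, determined by `⟨𝔖_β, 𝔖*_α⟩ = δ_{αβ}`. -/
def immaculate (β : Comp) : NSym := Classical.epsilon (IsDualTo dualImmaculate β)

/-- The row-strict immaculate function `ℛ𝔖_β`, determined by `⟨ℛ𝔖_β, ℛ𝔖*_α⟩ = δ_{αβ}`. -/
def rsImmaculate (β : Comp) : NSym := Classical.epsilon (IsDualTo rsDualImmaculate β)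

/-! ### Skew functions -/

/-- The containment `β ⊆ α`. (The parts of `β` are positive, so it forces `ℓ(β) ≤ ℓ(α)`.) -/
def Comp.Contained (β α : Comp) : Prop := ∀ j < β.len, β.part j ≤ α.part j

/-- The family `t` has only finitely many nonzero members, and their sum is `f`. -/
def IsFinSum {ι : Type} (t : ι → QSym) (f : QSym) : Prop :=
  (Function.support t).Finite ∧ ∑ᶠ i, t i = f

/-- The skew dual immaculate function `𝔖*_{α/β} = ∑_γ ⟨𝔖_β h_γ, 𝔖*_α⟩ M_γ`. -/
def skewDualImmaculate (α β : Comp) : QSym :=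
  ∑ᶠ γ : Comp, pairing (immaculate β * h γ) (dualImmaculate α) • M γ

/-- The skew row-strict dual immaculate function `ℛ𝔖*_{α/β} = ∑_γ ⟨ℛ𝔖_β h_γ, ℛ𝔖*_α⟩ M_γ`. -/
def skewRsDualImmaculate (α β : Comp) : QSym :=
  ∑ᶠ γ : Comp, pairing (rsImmaculate β * h γ) (rsDualImmaculate α) • M γ

/-! ### Paths -/

/-- The labelled cover relation `α →^m β` of the poset of immaculate tableaux: `β ⊂₁ α`, and `m`
is the row of `α` that holds the single additional box. -/
def Cover (α β : Comp) (m : ℕ) : Prop :=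
  α.size = β.size + 1 ∧ (∀ j < β.len, β.part j ≤ α.part j) ∧ α.len ≤ β.len + 1 ∧
    α.part m = β.part m + 1

/-- A path `α = β⁽⁰⁾ → β⁽¹⁾ → ⋯ → β⁽ᵏ⁾ = β` with labels `m₁, …, m_k`, where `m_{i+1}` is
`label i`. -/
structure Path (α β : Comp) where
  length : ℕ
  vertex : Fin (length + 1) → Comp
  label : Fin length → ℕ
  vertex_zero : vertex 0 = α
  vertex_last : vertex (Fin.last length) = β
  cover : ∀ i : Fin length, Cover (vertex i.castSucc) (vertex i.succ) (label i)

open scoped Classical in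
/-- The weak ascent set `A(P) = {k - i : 1 ≤ i < k, m_i ≤ m_{i+1}}`. (In the code `m_i` is
`label a` and `m_{i+1}` is `label b`, so `i = b`.) -/
def Path.ascSet {α β : Comp} (P : Path α β) : Finset ℕ :=
  (Finset.Icc 1 (P.length - 1)).filter fun d =>
    ∃ a b : Fin P.length, (b : ℕ) = a + 1 ∧ d + b = P.length ∧ P.label a ≤ P.label b

/-! ### Standard skew immaculate tableaux -/

/-- The cells of the skew shape `α/β`. -/
def skewDiagram (α β : Comp) : Finset (ℕ × ℕ) := diagram α \ diagram β

/-- Standard skew immaculate tableaux of shape `α/β`: the cells are filled bijectively with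
`1, …, k`, rows strictly increase from left to right, and the entries in the cells that lie in the
first column of `α` increase from bottom to top. -/
structure SkewTableau (α β : Comp) where
  entry : skewDiagram α β → ℕ
  injective : Function.Injective entry
  range_eq : Set.range entry = Set.Icc 1 (skewDiagram α β).card
  row_lt : ∀ p q : skewDiagram α β, p.1.1 = q.1.1 → p.1.2 < q.1.2 → entry p < entry q
  col_lt : ∀ p q : skewDiagram α β, p.1.2 = 0 → q.1.2 = 0 → p.1.1 < q.1.1 → entry p < entry q

open scoped Classical in
/-- The row-strict descent set of `T`: all `i` such that `i + 1` is weakly below `i` in `T`. -/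
def SkewTableau.rsDes {α β : Comp} (T : SkewTableau α β) : Finset ℕ :=
  (Finset.Icc 1 ((skewDiagram α β).card - 1)).filter fun i =>
    ∃ p q : skewDiagram α β, T.entry p = i ∧ T.entry q = i + 1 ∧ q.1.1 ≤ p.1.1

end

end RowStrictImmaculate

open RowStrictImmaculate

/-!
Both families of tableaux are `P`-partitions in the sense of Stanley. Cells are constrained by
`cellRel` (left of, in a row; below, in the first column), and the labelling `cellLab` of the cells
decides which inequalities are strict: reading rows from bottom to top, each from right to left,
gives the row-strict immaculate tableaux, and the reversed labelling gives the immaculate ones.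

Standardisation (`ppGen_eq_sum`) expands the generating function of the `P`-partitions as the sum
of `F_{comp(Des s)}` over the linear extensions `s`. Reversing the labelling complements every
descent set, so `psi` exchanges the two families (`psi_ppGen_toDual`), for straight and for skew
shapes alike.

A filling of `α` whose content is a concatenation `δ · γ` splits into a filling of some `β ⊆ α` with
content `δ` and a filling of `α/β` with content `γ` (`coeffAt_appendComp_cellGen`). Since
`h_δ h_γ = h_{δ · γ}`, this says that `⟨𝔖_β a, 𝔖*_α⟩ = ⟨a, G⟩`, where `G` is the generating function
of the fillings of `α/β`, and likewise for the row-strict family (`pairing_dual_mul`). Hence the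
skew functions are these generating functions, and their expansions along `M`, `F` and `ℛ𝔖*` are all
instances of the expansion of `G` in a family that has a dual family (`isFinSum_of_isDualTo`). The
dual immaculate functions are triangular for the dominance order, hence linearly independent;
`psi` carries this over to the row-strict ones, and linear independence together with homogeneity
gives existence and uniqueness of the dual family (`existsUnique_isDualTo`).

Finally, the linear extensions of `α/β` are the standard skew tableaux, and removing their cells one
after the other, the largest entry first, gives the paths from `α` to `β`
(`SkewLinExt.toTableau_bijective`, `SkewLinExt.toPath_surjective`); under both bijections the descent
sets agree, because in a row a later cell lies to the right.
-/

namespace RowStrictImmaculate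

open scoped Classical

/-! ### Compositions and their descent sets -/

theorem descSet_subset_Icc (c : Comp) : c.descSet ⊆ Finset.Icc 1 (c.size - 1) := by
  intro s hs
  rw [Comp.descSet, Finset.mem_image] at hs
  obtain ⟨r, hr, rfl⟩ := hs
  rw [Finset.mem_Icc] at hr ⊢
  have h1 := c.2.sizeUpTo_strict_mono (i := 0) (by omega)
  have h2 := c.2.monotone_sizeUpTo (show 0 + 1 ≤ r from hr.1)
  have h3 := c.2.sizeUpTo_strict_mono (i := r) (by omega)
  have h4 := c.2.sizeUpTo_le (r + 1)
  dsimp only [Comp.size]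
  omega

theorem descSet_compOf (n : ℕ) (S : Finset ℕ) (hS : S ⊆ Finset.Icc 1 (n - 1)) :
    (compOf n S).descSet = S := by
  have key : ∀ x : Fin (n + 1), (x = 0 ∨ x = Fin.last n ∨ (x : ℕ) ∈ (compOf n S).descSet) ↔
      (x = 0 ∨ x = Fin.last n ∨ (x : ℕ) ∈ S) := by
    intro x
    refine (mem_boundaries_iff (compOf n S) x).symm.trans ?_
    change x ∈ (CompositionAsSet.toComposition _).boundaries ↔ _
    rw [CompositionAsSet.toComposition_boundaries]
    simp
  ext d
  constructor
  · intro hd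
    have h1 := Finset.mem_Icc.1 (descSet_subset_Icc _ hd)
    change 1 ≤ d ∧ d ≤ n - 1 at h1
    have h2 := (key ⟨d, by omega⟩).1 (Or.inr (Or.inr hd))
    simp only [Fin.ext_iff, Fin.val_zero, Fin.val_last] at h2
    rcases h2 with h2 | h2 | h2
    · omega
    · omega
    · exact h2
  · intro hd
    have h1 := Finset.mem_Icc.1 (hS hd)
    have h2 := (key ⟨d, by omega⟩).2 (Or.inr (Or.inr hd))
    simp only [Fin.ext_iff, Fin.val_zero, Fin.val_last] at h2
    rcases h2 with h2 | h2 | h2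
    · omega
    · omega
    · exact h2

theorem compl_compOf (n : ℕ) (S : Finset ℕ) (hS : S ⊆ Finset.Icc 1 (n - 1)) :
    (compOf n S).compl = compOf n (Finset.Icc 1 (n - 1) \ S) := by
  rw [Comp.compl, descSet_compOf n S hS]
  rfl

theorem coarsens_compOf {n : ℕ} {S : Finset ℕ} (hS : S ⊆ Finset.Icc 1 (n - 1)) (c : Comp) :
    Comp.Coarsens (compOf n S) c ↔ n = c.size ∧ S ⊆ c.descSet := by
  rw [Comp.Coarsens, descSet_compOf n S hS]
  rfl

theorem eq_of_descSet_eq {α β : Comp} (hs : α.size = β.size) (hd : α.descSet = β.descSet) :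
    α = β := by
  rw [← compOf_descSet α, ← compOf_descSet β, hs, hd]

theorem psi_psi (f : QSym) : psi (psi f) = f := by
  have : psi ∘ₗ psi = LinearMap.id := by
    refine fundamentalBasis.ext fun γ => ?_
    rw [fundamentalBasis, Module.Basis.mk_apply, LinearMap.comp_apply, psi_F, psi_F,
      LinearMap.id_apply]
    congr 1
    conv_rhs => rw [← compOf_descSet γ, ← Finset.sdiff_sdiff_eq_self (descSet_subset_Icc γ)]
    exact compl_compOf _ _ Finset.sdiff_subset
  exact LinearMap.congr_fun this f

theorem psi_injective : Function.Injective psi :=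
  Function.LeftInverse.injective psi_psi

/-! ### Partitions of labelled posets -/

section PPartition

variable {C : Type} {Λ : Type*} [LinearOrder Λ]

/-- Stanley's `P`-partitions for the constraints `R` and the labelling `lab`: values weakly
increase along `R`, strictly so where `R` goes against the labelling. -/
def IsPPartition (R : C → C → Prop) (lab : C → Λ) (T : C → ℕ) : Prop :=
  ∀ p q, R p q → T p ≤ T q ∧ (lab q < lab p → T p < T q)

/-- The linear extensions of the constraints `R`, as enumerations of `C` by `Fin n`. -/
abbrev LinExt (R : C → C → Prop) (n : ℕ) : Type :=
  {s : C ≃ Fin n // ∀ p q, R p q → s p < s q}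

/-- The descents of an enumeration of `C` with respect to a labelling. Positions are counted
from `1`, so `d` is a descent when the label drops from the index `d - 1` to the index `d`. -/
noncomputable def desSet {n : ℕ} (lab : C → Λ) (s : C ≃ Fin n) : Finset ℕ :=
  (Finset.Icc 1 (n - 1)).filter fun d =>
    ∃ a b : Fin n, (b : ℕ) = a + 1 ∧ (b : ℕ) = d ∧ lab (s.symm b) < lab (s.symm a)

theorem desSet_subset {n : ℕ} (lab : C → Λ) (s : C ≃ Fin n) :
    desSet lab s ⊆ Finset.Icc 1 (n - 1) := Finset.filter_subset _ _

theorem mem_desSet {n : ℕ} (lab : C → Λ) (s : C ≃ Fin n) {a b : Fin n} (hab : (b : ℕ) = a + 1) :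
    (b : ℕ) ∈ desSet lab s ↔ lab (s.symm b) < lab (s.symm a) := by
  rw [desSet, Finset.mem_filter, Finset.mem_Icc]
  constructor
  · rintro ⟨-, a', b', h1, h2, h3⟩
    obtain rfl : b' = b := Fin.ext h2
    obtain rfl : a' = a := Fin.ext (by omega)
    exact h3
  · exact fun hl => ⟨by omega, a, b, hab, rfl, hl⟩

/-- Reversing the labelling complements the descent set. -/
theorem desSet_toDual {n : ℕ} {lab : C → Λ} (hlab : Function.Injective lab) (s : C ≃ Fin n) :
    desSet (OrderDual.toDual ∘ lab) s = Finset.Icc 1 (n - 1) \ desSet lab s := by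
  ext d
  rw [Finset.mem_sdiff]
  by_cases hd : d ∈ Finset.Icc 1 (n - 1)
  · have h1 := Finset.mem_Icc.1 hd
    have h2 := mem_desSet (OrderDual.toDual ∘ lab) s
      (a := ⟨d - 1, by omega⟩) (b := ⟨d, by omega⟩) (by dsimp only; omega)
    have h3 := mem_desSet lab s (a := ⟨d - 1, by omega⟩) (b := ⟨d, by omega⟩)
      (by dsimp only; omega)
    have h4 : lab (s.symm ⟨d, by omega⟩) ≠ lab (s.symm ⟨d - 1, by omega⟩) := fun h4 => by
      have := Fin.ext_iff.1 (s.symm.injective (hlab h4))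
      dsimp only at this
      omega
    dsimp only at h2 h3
    rw [h2, h3]
    simp only [Function.comp_apply, OrderDual.toDual_lt_toDual, hd, true_and, not_lt]
    exact ⟨le_of_lt, fun h5 => lt_of_le_of_ne h5 h4.symm⟩
  · exact iff_of_false (fun h1 => hd (desSet_subset _ _ h1)) (fun h1 => hd h1.1)

theorem strictMono_of_consecutive {X : Type*} [Preorder X] {n : ℕ} {f : Fin n → X}
    (hf : ∀ a b : Fin n, (b : ℕ) = a + 1 → f a < f b) : StrictMono f := by
  cases n with
  | zero => exact fun a => a.elim0
  | succ n => exact Fin.strictMono_iff_lt_succ.2 fun i => hf _ _ (by simp)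

/-- Values together with labels, in lexicographic order. Standardisation enumerates the cells in
the order of this key. -/
def key (lab : C → Λ) (T : C → ℕ) (p : C) : ℕ ×ₗ Λ := toLex (T p, lab p)

theorem key_injective {C : Type} {Λ : Type*} {lab : C → Λ} (hlab : Function.Injective lab) (T : C → ℕ) :
    Function.Injective (key lab T) := fun _ _ hpq =>
  hlab (congrArg (fun x => (ofLex x).2) hpq)

theorem key_lt {lab : C → Λ} {T : C → ℕ} {p q : C} :
    key lab T p < key lab T q ↔ T p < T q ∨ T p = T q ∧ lab p < lab q :=
  Prod.Lex.toLex_lt_toLex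

/-- If `s` enumerates `C` in the order of the keys of `T`, then `T` is a `P`-partition exactly if
`s` is a linear extension. -/
theorem isPPartition_iff {R : C → C → Prop} (hR : ∀ p, ¬ R p p) {lab : C → Λ}
    (hlab : Function.Injective lab) {n : ℕ} {T : C → ℕ} {s : C ≃ Fin n}
    (hs : StrictMono fun j => key lab T (s.symm j)) :
    IsPPartition R lab T ↔ ∀ p q, R p q → s p < s q := by
  refine forall_congr' fun p => forall_congr' fun q => forall_congr' fun hpq => ?_
  have h1 : s p < s q ↔ key lab T p < key lab T q := by
    have := hs.lt_iff_lt (a := s p) (b := s q)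
    simpa using this.symm
  have h2 : lab p ≠ lab q := fun h2 => hR p (by rw [hlab h2] at hpq ⊢; exact hpq)
  rw [h1, key_lt]
  rcases lt_or_gt_of_ne h2 with h3 | h3
  · simp [h3, h3.not_gt, le_iff_lt_or_eq]
  · simp only [h3, h3.not_gt, and_false, or_false, true_imp_iff]
    exact ⟨And.right, fun h4 => ⟨h4.le, h4⟩⟩

/-- Replacing each position by the index of its block in `c` is undone by standardisation exactly if
the labels increase within the blocks. -/
theorem strictMono_key_index {n : ℕ} (c : Composition n) {lab : C → Λ}
    (hlab : Function.Injective lab) (s : C ≃ Fin n) :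
    (StrictMono fun j => key lab (fun p => (c.index (s p) : ℕ)) (s.symm j)) ↔
      desSet lab s ⊆ Comp.descSet ⟨n, c⟩ := by
  constructor
  · intro hs d hd
    have h1 := Finset.mem_Icc.1 (desSet_subset _ _ hd)
    have hd' := (mem_desSet lab s (a := ⟨d - 1, by omega⟩) (b := ⟨d, by omega⟩)
      (by dsimp only; omega)).1 hd
    by_contra hdc
    have h2 := (index_eq_iff (c := ⟨n, c⟩)
      (a := ⟨d - 1, show d - 1 < n by omega⟩) (b := ⟨d, show d < n by omega⟩) (by dsimp only; omega)).2 hdc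
    have h3 := hs (show (⟨d - 1, by omega⟩ : Fin n) < ⟨d, by omega⟩ by
      rw [Fin.mk_lt_mk]; omega)
    rw [key_lt] at h3
    simp only [Equiv.apply_symm_apply] at h3
    dsimp only at h2
    rw [h2] at h3
    exact (h3.resolve_left (lt_irrefl _)).2.not_gt hd'
  · intro hs
    refine strictMono_of_consecutive fun a b hab => ?_
    rw [key_lt]
    simp only [Equiv.apply_symm_apply]
    have h1 : c.index a ≤ c.index b := index_mono c (by rw [Fin.le_def]; omega)
    rcases h1.lt_or_eq with h1 | h1
    · exact Or.inl h1
    · refine Or.inr ⟨congrArg _ h1, ?_⟩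
      have h2 := (index_eq_iff (c := ⟨n, c⟩) hab).1 h1
      have h3 := fun h3 => h2 (hs ((mem_desSet lab s hab).2 h3))
      refine lt_of_le_of_ne (not_lt.1 h3) fun h4 => ?_
      have := s.symm.injective (hlab h4)
      rw [this] at hab
      omega

variable [Fintype C]

theorem content_comp_equiv {n : ℕ} (s : C ≃ Fin n) (T : C → ℕ) :
    content (fun _ => 1) (T ∘ s.symm) = content (fun _ => 1) T :=
  Equiv.sum_comp s.symm fun p => Finsupp.single (T p) 1

/-- Standardisation: `P`-partitions whose content is given by the composition `c` correspond to
linear extensions with descents only at the partial sums of `c`. -/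
theorem card_isPPartition {R : C → C → Prop} (hR : ∀ p, ¬ R p p) {lab : C → Λ}
    (hlab : Function.Injective lab) {n : ℕ} (hn : Fintype.card C = n) (c : Composition n) :
    Nat.card {T : C → ℕ // IsPPartition R lab T ∧ content (fun _ => 1) T = expo ⟨n, c⟩} =
      Nat.card {s : LinExt R n // desSet lab s.1 ⊆ Comp.descSet ⟨n, c⟩} := by
  symm
  refine Nat.card_congr (Equiv.ofBijective
    (fun s => ⟨fun p => (c.index (s.1.1 p) : ℕ), ?_, ?_⟩) ⟨?_, ?_⟩)
  · exact (isPPartition_iff hR hlab ((strictMono_key_index c hlab s.1.1).2 s.2)).2 s.1.2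
  · rw [← content_comp_equiv s.1.1, ← content_index ⟨n, c⟩]
    congr 1
    funext j
    simp
  · intro s s' hss
    have h1 : (fun p => (c.index (s.1.1 p) : ℕ)) = fun p => (c.index (s'.1.1 p) : ℕ) :=
      congrArg Subtype.val hss
    have h2 := (strictMono_key_index c hlab s.1.1).2 s.2
    have h3 := (strictMono_key_index c hlab s'.1.1).2 s'.2
    rw [h1] at h2
    -- both enumerations list the same set of keys increasingly, so they agree
    have h4 := (StrictMono.range_inj h2 h3).1 (by
      have e : ∀ (u : C ≃ Fin n) (f : C → ℕ ×ₗ Λ), Set.range (fun j => f (u.symm j)) =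
        Set.range f := fun u f => u.symm.surjective.range_comp f
      rw [e, e])
    refine Subtype.ext (Subtype.ext ?_)
    rw [← Equiv.symm_symm s.1.1, ← Equiv.symm_symm s'.1.1]
    congr 1
    ext j
    exact key_injective hlab _ (congrFun h4 j)
  · rintro ⟨T, hT, hc⟩
    have hcard : (Finset.univ.image (key lab T)).card = n := by
      rw [Finset.card_image_of_injective _ (key_injective hlab T), Finset.card_univ, hn]
    -- enumerate the cells in the order of their keys
    set e := (Finset.univ.image (key lab T)).orderEmbOfFin hcard with he
    have hmem : ∀ j, ∃ p, key lab T p = e j := fun j => by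
      obtain ⟨p, -, hp⟩ := Finset.mem_image.1 (Finset.orderEmbOfFin_mem _ hcard j)
      exact ⟨p, hp⟩
    choose u hu using hmem
    have hui : Function.Injective u := fun i j hij => e.injective (by rw [← hu, ← hu, hij])
    have hub : Function.Bijective u :=
      (Fintype.bijective_iff_injective_and_card u).2 ⟨hui, by simp [hn]⟩
    set s : C ≃ Fin n := (Equiv.ofBijective u hub).symm with hs
    have hsu : ∀ j, s.symm j = u j := fun j => rfl
    have hmono : StrictMono fun j => key lab T (s.symm j) := by
      simp only [hsu, hu]
      exact e.strictMono
    have hTs : T ∘ s.symm = fun j => (c.index j : ℕ) := by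
      refine monotone_eq_of_content ?_ (fun _ _ hxy => index_mono _ hxy)
        ((content_comp_equiv s T).trans (hc.trans (content_index ⟨n, c⟩).symm))
      intro i j hij
      rcases hij.lt_or_eq with hij | rfl
      · rcases key_lt.1 (hmono hij) with h1 | h1
        · exact h1.le
        · exact h1.1.le
      · exact le_rfl
    have hT' : T = fun p => (c.index (s p) : ℕ) := by
      funext p
      have := congrFun hTs (s p)
      simpa using this
    refine ⟨⟨⟨s, (isPPartition_iff hR hlab hmono).1 hT⟩, ?_⟩, Subtype.ext hT'.symm⟩
    refine (strictMono_key_index c hlab s).1 ?_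
    rw [← hT']
    exact hmono

/-- The generating function of the `P`-partitions of a labelled poset. -/
noncomputable def ppGen (R : C → C → Prop) (lab : C → Λ) : QSym :=
  ⟨genFun (fun _ => 1) (IsPPartition R lab),
    genFun_mem_QSym _ (fun _ => Nat.one_pos) _ fun T T' e hT p q hpq => by
      have h1 := hT p q hpq
      have h2 := e q p
      have h3 := e p q
      exact ⟨by omega, fun hl => h3.1 (h1.2 hl)⟩⟩

theorem coeffAt_ppGen (R : C → C → Prop) (lab : C → Λ) (c : Comp) :
    coeffAt c (ppGen R lab) =
      (Nat.card {T : C → ℕ // IsPPartition R lab T ∧ content (fun _ => 1) T = expo c} : ℚ) := rfl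

theorem coeffAt_ppGen_of_size_ne (R : C → C → Prop) (lab : C → Λ) {c : Comp}
    (hc : c.size ≠ Fintype.card C) : coeffAt c (ppGen R lab) = 0 := by
  rw [coeffAt_ppGen]
  have : IsEmpty {T : C → ℕ // IsPPartition R lab T ∧ content (fun _ => 1) T = expo c} :=
    ⟨fun T => hc (by
      have h1 := congrArg Finsupp.degree T.2.2
      rw [content_degree, expo_degree] at h1
      simpa using h1.symm)⟩
  simp

/-- The fundamental expansion of the generating function of `P`-partitions. -/
theorem ppGen_eq_sum {R : C → C → Prop} (hR : ∀ p, ¬ R p p) {lab : C → Λ}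
    (hlab : Function.Injective lab) {n : ℕ} (hn : Fintype.card C = n) [Fintype (LinExt R n)] :
    ppGen R lab = ∑ s : LinExt R n, F (compOf n (desSet lab s.1)) := by
  refine qsym_ext fun c => ?_
  simp only [map_sum, coeffAt_F, coarsens_compOf (desSet_subset _ _)]
  by_cases hc : n = c.size
  · obtain ⟨m, c⟩ := c
    obtain rfl : n = m := hc
    rw [coeffAt_ppGen, card_isPPartition hR hlab hn, Nat.card_eq_fintype_card,
      Fintype.card_subtype]
    simp
  · rw [coeffAt_ppGen_of_size_ne _ _ (fun h1 => hc (by rw [h1, hn]))]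
    simp [hc]

theorem psi_ppGen_toDual {R : C → C → Prop} (hR : ∀ p, ¬ R p p) {lab : C → Λ}
    (hlab : Function.Injective lab) :
    psi (ppGen R (OrderDual.toDual ∘ lab)) = ppGen R lab := by
  rw [ppGen_eq_sum hR (OrderDual.toDual.injective.comp hlab) rfl, ppGen_eq_sum hR hlab rfl,
    map_sum]
  refine Finset.sum_congr rfl fun s _ => ?_
  rw [psi_F, desSet_toDual hlab, compl_compOf _ _ Finset.sdiff_subset,
    Finset.sdiff_sdiff_eq_self (desSet_subset _ _)]

end PPartition

/-! ### Diagrams -/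

theorem part_eq_blocksFun (c : Comp) {r : ℕ} (hr : r < c.len) :
    c.part r = c.2.blocksFun ⟨r, hr⟩ := List.getD_eq_getElem _ _ hr

theorem part_pos_iff (c : Comp) (r : ℕ) : 0 < c.part r ↔ r < c.len := by
  constructor
  · intro hr
    by_contra hl
    rw [Comp.part, List.getD_eq_default _ _ (not_lt.1 hl)] at hr
    exact lt_irrefl _ hr
  · intro hr
    rw [part_eq_blocksFun c hr]
    exact c.2.one_le_blocksFun _

theorem comp_ext {α β : Comp} (hp : ∀ r, α.part r = β.part r) : α = β := by
  have hlen : α.len = β.len := by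
    refine le_antisymm (not_lt.1 fun hl => ?_) (not_lt.1 fun hl => ?_)
    · exact lt_irrefl _ ((part_pos_iff β _).1 (hp β.len ▸ (part_pos_iff α _).2 hl))
    · exact lt_irrefl _ ((part_pos_iff α _).1 ((hp α.len).symm ▸ (part_pos_iff β _).2 hl))
  rw [Composition.sigma_eq_iff_blocks_eq]
  refine List.ext_getElem hlen fun r h1 h2 => ?_
  have := hp r
  rwa [Comp.part, Comp.part, List.getD_eq_getElem _ _ h1, List.getD_eq_getElem _ _ h2] at this

theorem diagram_injective : Function.Injective diagram := by
  intro α β hαβ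
  refine comp_ext fun r => ?_
  have key : ∀ j, j < α.part r ↔ j < β.part r := fun j => by
    rw [← mem_diagram α (r, j), ← mem_diagram β (r, j), hαβ]
  have h1 := key (α.part r)
  have h2 := key (β.part r)
  omega

theorem card_row_diagram (α : Comp) (r : ℕ) :
    ((diagram α).filter fun p => p.1 = r).card = α.part r := by
  refine Eq.trans ?_ ((Finset.card_map (s := Finset.range (α.part r))
    ⟨fun j => (r, j), fun _ _ hij => (Prod.ext_iff.1 hij).2⟩).trans (Finset.card_range _))
  refine congrArg Finset.card (Finset.ext ?_)
  rintro ⟨a, b⟩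
  simp only [Finset.mem_filter, mem_diagram, Finset.mem_map, Finset.mem_range]
  constructor
  · rintro ⟨h1, rfl⟩
    exact ⟨b, h1, rfl⟩
  · rintro ⟨x, h1, h2⟩
    obtain ⟨rfl, rfl⟩ := Prod.ext_iff.1 h2
    exact ⟨h1, rfl⟩

theorem card_diagram (α : Comp) : (diagram α).card = α.size := by
  rw [Finset.card_eq_sum_card_fiberwise (f := Prod.fst) (t := Finset.range α.len)]
  · simp only [card_row_diagram]
    rw [Finset.sum_range]
    refine Eq.trans (Finset.sum_congr rfl fun r _ => ?_) α.2.sum_blocksFun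
    exact part_eq_blocksFun α r.2
  · intro p hp
    rw [Finset.mem_coe, mem_diagram] at hp
    rw [Finset.mem_coe, Finset.mem_range, ← part_pos_iff]
    omega

theorem contained_iff (β α : Comp) : Comp.Contained β α ↔ diagram β ⊆ diagram α := by
  constructor
  · intro hc p hp
    rw [mem_diagram] at hp ⊢
    exact hp.trans_le (hc _ ((part_pos_iff β _).1 (by omega)))
  · intro hs j _
    by_contra hlt
    have h1 := hs ((mem_diagram β (j, α.part j)).2 (not_le.1 hlt))
    rw [mem_diagram] at h1
    exact lt_irrefl _ h1

/-- The order constraints of immaculate tableaux: `p` is to the left of `q` in the same row, or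
`p` is below `q` in the first column. -/
def cellRel (p q : ℕ × ℕ) : Prop :=
  (p.1 = q.1 ∧ p.2 < q.2) ∨ (p.2 = 0 ∧ q.2 = 0 ∧ p.1 < q.1)

theorem cellRel_irrefl (p : ℕ × ℕ) : ¬ cellRel p p := by
  rintro (⟨-, hp⟩ | ⟨-, -, hp⟩) <;> exact lt_irrefl _ hp

theorem mem_diagram_of_cellRel {α : Comp} {p q : ℕ × ℕ} (hpq : cellRel p q)
    (hq : q ∈ diagram α) : p ∈ diagram α := by
  rw [mem_diagram] at hq ⊢
  rcases hpq with ⟨h1, h2⟩ | ⟨h1, h2, h3⟩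
  · rw [h1]
    exact h2.trans hq
  · rw [h1, part_pos_iff]
    exact h3.trans ((part_pos_iff α _).1 (by omega))

theorem mem_iff_lt_card {S : Finset ℕ} (hS : ∀ i j, i < j → j ∈ S → i ∈ S) (i : ℕ) :
    i ∈ S ↔ i < S.card := by
  constructor
  · intro hi
    have : Finset.range (i + 1) ⊆ S := fun j hj => by
      rcases (Nat.lt_succ_iff.1 (Finset.mem_range.1 hj)).lt_or_eq with h1 | rfl
      · exact hS _ _ h1 hi
      · exact hi
    simpa using Finset.card_le_card this
  · intro hi
    by_contra hni
    have : S ⊆ Finset.range i := fun j hj => by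
      rw [Finset.mem_range]
      by_contra hij
      rcases (not_lt.1 hij).lt_or_eq with h1 | rfl
      · exact hni (hS _ _ h1 hj)
      · exact hni hj
    have := Finset.card_le_card this
    rw [Finset.card_range] at this
    omega

/-- The diagrams of compositions are exactly the finite sets of cells closed under `cellRel`. -/
theorem exists_diagram_eq (D : Finset (ℕ × ℕ)) (hD : ∀ p q, cellRel p q → q ∈ D → p ∈ D) :
    ∃ β : Comp, diagram β = D := by
  set row : ℕ → Finset ℕ := fun r => (D.filter fun p => p.1 = r).image Prod.snd with hrow
  have mem_row : ∀ r j, j ∈ row r ↔ (r, j) ∈ D := by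
    intro r j
    simp only [hrow, Finset.mem_image, Finset.mem_filter]
    constructor
    · rintro ⟨⟨a, b⟩, ⟨h1, rfl⟩, rfl⟩
      exact h1
    · exact fun h1 => ⟨(r, j), ⟨h1, rfl⟩, rfl⟩
  have row_iff : ∀ r j, (r, j) ∈ D ↔ j < (row r).card := fun r j => by
    rw [← mem_row]
    refine mem_iff_lt_card (fun i j hij hj => ?_) j
    rw [mem_row] at hj ⊢
    exact hD (r, i) (r, j) (Or.inl ⟨rfl, hij⟩) hj
  set col : Finset ℕ := (D.filter fun p => p.2 = 0).image Prod.fst with hcol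
  have mem_col : ∀ r, r ∈ col ↔ (r, 0) ∈ D := by
    intro r
    simp only [hcol, Finset.mem_image, Finset.mem_filter]
    constructor
    · rintro ⟨⟨a, b⟩, ⟨h1, rfl⟩, rfl⟩
      exact h1
    · exact fun h1 => ⟨(r, 0), ⟨h1, rfl⟩, rfl⟩
  have col_iff : ∀ r, (r, 0) ∈ D ↔ r < col.card := fun r => by
    rw [← mem_col]
    refine mem_iff_lt_card (fun i j hij hj => ?_) r
    rw [mem_col] at hj ⊢
    exact hD (i, 0) (j, 0) (Or.inr ⟨rfl, rfl, hij⟩) hj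
  refine ⟨⟨_, ⟨(List.range col.card).map fun r => (row r).card, ?_, rfl⟩⟩, ?_⟩
  · intro i hi
    obtain ⟨r, hr, rfl⟩ := List.mem_map.1 hi
    exact (row_iff r 0).1 ((col_iff r).2 (List.mem_range.1 hr))
  · ext ⟨r, j⟩
    rw [mem_diagram, Comp.part]
    dsimp only
    by_cases hr : r < col.card
    · rw [List.getD_eq_getElem _ _ (by simpa using hr), row_iff]
      simp
    · rw [List.getD_eq_default _ _ (by simpa using hr)]
      refine iff_of_false (Nat.not_lt_zero _) fun h1 => hr ?_
      rw [← col_iff]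
      rcases Nat.eq_zero_or_pos j with rfl | hj
      · exact h1
      · exact hD (r, 0) (r, j) (Or.inl ⟨rfl, hj⟩) h1

/-! ### Generating functions of fillings -/

/-- Rows are read from bottom to top, and each row from right to left. Row-strict immaculate
tableaux are the partitions for this labelling, immaculate tableaux those for its reverse. -/
def cellLab (p : ℕ × ℕ) : ℕ ×ₗ ℕᵒᵈ := toLex (p.1, OrderDual.toDual p.2)

theorem cellLab_injective : Function.Injective cellLab := fun _ _ hpq =>
  Prod.ext (congrArg (fun x => (ofLex x).1) hpq) (congrArg (fun x => (ofLex x).2) hpq)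

theorem cellLab_lt {p q : ℕ × ℕ} :
    cellLab p < cellLab q ↔ p.1 < q.1 ∨ p.1 = q.1 ∧ q.2 < p.2 :=
  Prod.Lex.toLex_lt_toLex

section Labelled

variable {Λ : Type} [LinearOrder Λ]

/-- The generating function of the fillings of a set of cells that obey the constraints
`cellRel`, weakly or strictly according to the labelling. -/
noncomputable def cellGen (D : Finset (ℕ × ℕ)) (lab : ℕ × ℕ → Λ) : QSym :=
  ppGen (fun p q : D => cellRel p.1 q.1) fun p : D => lab p.1

theorem rsDualImmaculate_eq (α : Comp) : rsDualImmaculate α = cellGen (diagram α) cellLab := by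
  refine Subtype.ext ?_
  change genFun _ _ = genFun _ _
  congr 1
  funext T
  refine propext ⟨fun hT p q hpq => ?_, fun hT => ⟨fun p q hp hq hpq => ?_, fun p q hp hpq => ?_⟩⟩
  · rcases hpq with ⟨h1, h2⟩ | ⟨h1, h2, h3⟩
    · exact ⟨(hT.2 p q h1 h2).le, fun _ => hT.2 p q h1 h2⟩
    · refine ⟨hT.1 p q h1 h2 h3, fun h4 => ?_⟩
      rw [cellLab_lt] at h4
      omega
  · exact (hT p q (Or.inr ⟨hp, hq, hpq⟩)).1
  · exact (hT p q (Or.inl ⟨hp, hpq⟩)).2 (cellLab_lt.2 (Or.inr ⟨hp.symm, hpq⟩))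

theorem dualImmaculate_eq (α : Comp) :
    dualImmaculate α = cellGen (diagram α) (OrderDual.toDual ∘ cellLab) := by
  refine Subtype.ext ?_
  change genFun _ _ = genFun _ _
  congr 1
  funext T
  refine propext ⟨fun hT p q hpq => ?_, fun hT => ⟨fun p q hp hq hpq => ?_, fun p q hp hpq => ?_⟩⟩
  · rcases hpq with ⟨h1, h2⟩ | ⟨h1, h2, h3⟩
    · refine ⟨hT.2 p q h1 h2, fun h4 => ?_⟩
      have h5 := cellLab_lt.1 (OrderDual.toDual_lt_toDual.1 h4)
      omega
    · exact ⟨(hT.1 p q h1 h2 h3).le, fun _ => hT.1 p q h1 h2 h3⟩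
  · exact (hT p q (Or.inr ⟨hp, hq, hpq⟩)).2
      (OrderDual.toDual_lt_toDual.2 (cellLab_lt.2 (Or.inl hpq)))
  · exact (hT p q (Or.inl ⟨hp, hpq⟩)).1

theorem psi_cellGen (D : Finset (ℕ × ℕ)) :
    psi (cellGen D (OrderDual.toDual ∘ cellLab)) = cellGen D cellLab :=
  psi_ppGen_toDual (fun p => cellRel_irrefl p.1) (cellLab_injective.comp Subtype.val_injective)

theorem psi_dualImmaculate (α : Comp) : psi (dualImmaculate α) = rsDualImmaculate α := by
  rw [dualImmaculate_eq, rsDualImmaculate_eq, psi_cellGen]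

/-- The fillings of `D` that obey the constraints and have content `c`, as functions on all cells
that vanish off `D`. -/
def IsFilling (lab : ℕ × ℕ → Λ) (D : Finset (ℕ × ℕ)) (c : Comp) (T : ℕ × ℕ → ℕ) : Prop :=
  (∀ p ∉ D, T p = 0) ∧
  (∀ p ∈ D, ∀ q ∈ D, cellRel p q → T p ≤ T q ∧ (lab q < lab p → T p < T q)) ∧
  ∀ x, (D.filter fun p => T p = x).card = c.part x

theorem expo_apply (c : Comp) (x : ℕ) : expo c x = c.part x := by
  rw [expo, monoExp, Finsupp.finsetSum_apply]
  by_cases hx : x < c.len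
  · rw [part_eq_blocksFun c hx, Finset.sum_eq_single ⟨x, hx⟩]
    · simp
    · intro j _ hj
      exact Finsupp.single_eq_of_ne' (fun hh => hj (Fin.ext hh))
    · simp
  · rw [Nat.eq_zero_of_not_pos (mt (part_pos_iff c x).1 hx)]
    refine Finset.sum_eq_zero fun j _ => Finsupp.single_eq_of_ne' fun hj => hx ?_
    rw [← hj]
    exact j.2

theorem content_apply (D : Finset (ℕ × ℕ)) (T : ℕ × ℕ → ℕ) (x : ℕ) :
    content (fun _ => 1) (fun p : D => T p) x = (D.filter fun p => T p = x).card := by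
  rw [content, Finsupp.finsetSum_apply, Finset.card_filter,
    ← Finset.sum_coe_sort D fun p => if T p = x then 1 else 0]
  simp only [Finsupp.single_apply]

theorem IsFilling.lt_len {lab : ℕ × ℕ → Λ} {D : Finset (ℕ × ℕ)} {c : Comp} {T : ℕ × ℕ → ℕ}
    (hT : IsFilling lab D c T) {p : ℕ × ℕ} (hp : p ∈ D) : T p < c.len := by
  rw [← part_pos_iff, ← hT.2.2, Finset.card_pos]
  exact ⟨p, Finset.mem_filter.2 ⟨hp, rfl⟩⟩

theorem coeffAt_cellGen (lab : ℕ × ℕ → Λ) (D : Finset (ℕ × ℕ)) (c : Comp) :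
    coeffAt c (cellGen D lab) = (Nat.card {T // IsFilling lab D c T} : ℚ) := by
  rw [cellGen, coeffAt_ppGen]
  congr 1
  symm
  refine Nat.card_congr (Equiv.ofBijective (fun T => ⟨fun p => T.1 p, ?_, ?_⟩) ⟨?_, ?_⟩)
  · exact fun p q hpq => T.2.2.1 p p.2 q q.2 hpq
  · ext x
    rw [content_apply, expo_apply, T.2.2.2]
  · intro T T' hTT
    refine Subtype.ext (funext fun p => ?_)
    by_cases hp : p ∈ D
    · exact congrFun (congrArg Subtype.val hTT) ⟨p, hp⟩
    · rw [T.2.1 p hp, T'.2.1 p hp]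
  · rintro ⟨T, hT, hc⟩
    have hext : (fun p : D => if hp : p.1 ∈ D then T ⟨p.1, hp⟩ else 0) = T := by
      funext p
      simp
    refine ⟨⟨fun p => if hp : p ∈ D then T ⟨p, hp⟩ else 0, ?_, ?_, ?_⟩, Subtype.ext hext⟩
    · exact fun p hp => dif_neg hp
    · intro p hp q hq hpq
      simp only [hp, hq, dif_pos]
      exact hT ⟨p, hp⟩ ⟨q, hq⟩ hpq
    · intro x
      rw [← content_apply D, ← expo_apply, ← hc, hext]

theorem finite_isFilling (lab : ℕ × ℕ → Λ) (D : Finset (ℕ × ℕ)) (c : Comp) :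
    Finite {T // IsFilling lab D c T} := by
  refine Finite.of_injective
    (fun T => fun p : D => (⟨T.1 p, T.2.lt_len p.2⟩ : Fin c.len)) fun T T' hTT => ?_
  refine Subtype.ext (funext fun p => ?_)
  by_cases hp : p ∈ D
  · exact congrArg Fin.val (congrFun hTT ⟨p, hp⟩)
  · rw [T.2.1 p hp, T'.2.1 p hp]

/-! ### Splitting fillings into small and large entries -/

/-- The concatenation of two compositions. -/
def appendComp (δ γ : Comp) : Comp := ⟨δ.size + γ.size, δ.2.append γ.2⟩

theorem part_appendComp_left {δ γ : Comp} {x : ℕ} (hx : x < δ.len) :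
    (appendComp δ γ).part x = δ.part x :=
  List.getD_append _ _ _ _ hx

theorem part_appendComp_right {δ γ : Comp} (x : ℕ) :
    (appendComp δ γ).part (δ.len + x) = γ.part x := by
  refine (List.getD_append_right _ _ _ _ (Nat.le_add_right _ _)).trans ?_
  rw [Comp.part]
  congr 1
  exact Nat.add_sub_cancel_left _ _

/-- The compositions contained in `α`. -/
noncomputable def subComps (α : Comp) : Finset Comp :=
  ((Finset.range (α.size + 1)).sigma fun n => (Finset.univ : Finset (Composition n))).filter
    fun β => Comp.Contained β α

theorem mem_subComps {α β : Comp} : β ∈ subComps α ↔ Comp.Contained β α := by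
  rw [subComps, Finset.mem_filter, Finset.mem_sigma, Finset.mem_range]
  refine ⟨And.right, fun hc => ⟨⟨?_, Finset.mem_univ _⟩, hc⟩⟩
  have := Finset.card_le_card ((contained_iff β α).1 hc)
  rw [card_diagram, card_diagram] at this
  exact Nat.lt_succ_of_le this

/-- The filling of `α` by `T₁` on `β` and by `T₂`, shifted by `l`, on `α/β`. -/
noncomputable def glue (α β : Comp) (l : ℕ) (T₁ T₂ : ℕ × ℕ → ℕ) (p : ℕ × ℕ) : ℕ :=
  if p ∈ diagram β then T₁ p else if p ∈ diagram α then l + T₂ p else 0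

theorem card_filter_split {α β : Comp} (hβ : Comp.Contained β α) (P : ℕ × ℕ → Prop)
    [DecidablePred P] :
    ((diagram α).filter P).card =
      ((diagram β).filter P).card + ((skewDiagram α β).filter P).card := by
  rw [← Finset.card_union_of_disjoint]
  · rw [← Finset.filter_union, skewDiagram,
      Finset.union_sdiff_of_subset ((contained_iff β α).1 hβ)]
  · exact Finset.disjoint_filter_filter (Finset.disjoint_sdiff)

/-- If `T` has its entries below `ℓ(δ)` exactly in `β`, then `T` is a filling of content `δ · γ`
exactly if its restriction to `β` has content `δ` and its restriction to `α/β`, shifted by `ℓ(δ)`,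
has content `γ`. The constraints between `β` and `α/β` hold automatically. -/
theorem isFilling_glue_iff {lab : ℕ × ℕ → Λ} {α β δ γ : Comp} (hβ : Comp.Contained β α)
    {T : ℕ × ℕ → ℕ} (hT0 : ∀ p ∉ diagram α, T p = 0)
    (hTβ : ∀ p ∈ diagram α, T p < δ.len ↔ p ∈ diagram β) :
    IsFilling lab (diagram α) (appendComp δ γ) T ↔
      IsFilling lab (diagram β) δ (fun p => if p ∈ diagram β then T p else 0) ∧
      IsFilling lab (skewDiagram α β) γ
        (fun p => if p ∈ skewDiagram α β then T p - δ.len else 0) := by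
  have hβα := (contained_iff β α).1 hβ
  have hskew : ∀ p, p ∈ skewDiagram α β ↔ p ∈ diagram α ∧ p ∉ diagram β := fun p =>
    Finset.mem_sdiff
  have hlow : ∀ p ∈ diagram β, T p < δ.len := fun p hp => (hTβ p (hβα hp)).2 hp
  have hhigh : ∀ p ∈ skewDiagram α β, δ.len ≤ T p := fun p hp =>
    not_lt.1 fun hl => ((hskew p).1 hp).2 ((hTβ p ((hskew p).1 hp).1).1 hl)
  have hc1 : ∀ x, ((diagram β).filter fun p => (if p ∈ diagram β then T p else 0) = x) =
      (diagram β).filter fun p => T p = x := fun x =>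
    Finset.filter_congr fun p hp => by rw [if_pos hp]
  have hc2 : ∀ x, ((skewDiagram α β).filter
      fun p => (if p ∈ skewDiagram α β then T p - δ.len else 0) = x) =
      (skewDiagram α β).filter fun p => T p = δ.len + x := fun x =>
    Finset.filter_congr fun p hp => by
      rw [if_pos hp]
      have := hhigh p hp
      omega
  have hc3 : ∀ x, δ.len ≤ x → ((diagram β).filter fun p => T p = x).card = 0 := fun x hx => by
    rw [Finset.card_eq_zero, Finset.filter_eq_empty_iff]
    intro p hp
    have := hlow p hp
    omega
  have hc4 : ∀ x, x < δ.len → ((skewDiagram α β).filter fun p => T p = x).card = 0 :=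
    fun x hx => by
      rw [Finset.card_eq_zero, Finset.filter_eq_empty_iff]
      intro p hp
      have := hhigh p hp
      omega
  constructor
  · rintro ⟨-, hT, hc⟩
    refine ⟨⟨fun p hp => if_neg hp, fun p hp q hq hpq => ?_, fun x => ?_⟩,
      ⟨fun p hp => if_neg hp, fun p hp q hq hpq => ?_, fun x => ?_⟩⟩
    · dsimp only
      rw [if_pos hp, if_pos hq]
      exact hT p (hβα hp) q (hβα hq) hpq
    · rw [hc1]
      by_cases hx : x < δ.len
      · rw [← part_appendComp_left (γ := γ) hx, ← hc, card_filter_split hβ, hc4 x hx, add_zero]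
      · rw [hc3 x (not_lt.1 hx), Nat.eq_zero_of_not_pos (mt (part_pos_iff δ x).1 hx)]
    · dsimp only
      rw [if_pos hp, if_pos hq]
      have h1 := hT p ((hskew p).1 hp).1 q ((hskew q).1 hq).1 hpq
      have h2 := hhigh p hp
      exact ⟨by omega, fun hl => by have := h1.2 hl; omega⟩
    · rw [hc2, ← part_appendComp_right (δ := δ), ← hc, card_filter_split hβ,
        hc3 _ (Nat.le_add_right _ _), zero_add]
  · rintro ⟨⟨-, h1, h2⟩, ⟨-, h3, h4⟩⟩
    refine ⟨hT0, fun p hp q hq hpq => ?_, fun x => ?_⟩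
    · by_cases hqβ : q ∈ diagram β
      · have hpβ := mem_diagram_of_cellRel hpq hqβ
        have := h1 p hpβ q hqβ hpq
        dsimp only at this
        rwa [if_pos hpβ, if_pos hqβ] at this
      · have hq' := (hskew q).2 ⟨hq, hqβ⟩
        have hq2 := hhigh q hq'
        by_cases hpβ : p ∈ diagram β
        · have := hlow p hpβ
          exact ⟨by omega, fun _ => by omega⟩
        · have hp' := (hskew p).2 ⟨hp, hpβ⟩
          have hp2 := hhigh p hp'
          have := h3 p hp' q hq' hpq
          dsimp only at this
          rw [if_pos hp', if_pos hq'] at this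
          exact ⟨by omega, fun hl => by have := this.2 hl; omega⟩
    · rw [card_filter_split hβ]
      by_cases hx : x < δ.len
      · rw [part_appendComp_left hx, ← h2, hc1, hc4 x hx, add_zero]
      · obtain ⟨y, rfl⟩ := Nat.exists_eq_add_of_le (not_lt.1 hx)
        rw [part_appendComp_right, ← h4, hc2, hc3 _ (Nat.le_add_right _ _), zero_add]

theorem card_isFilling_append (lab : ℕ × ℕ → Λ) (α δ γ : Comp) :
    Nat.card {T // IsFilling lab (diagram α) (appendComp δ γ) T} =
      ∑ β ∈ subComps α, Nat.card {T // IsFilling lab (diagram β) δ T} *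
        Nat.card {T // IsFilling lab (skewDiagram α β) γ T} := by
  rw [← Finset.sum_coe_sort]
  simp only [← Nat.card_prod]
  have fin1 := fun D c => finite_isFilling lab D c
  rw [← Nat.card_sigma]
  symm
  have glue_iff : ∀ (β : subComps α) (T₁ : {T // IsFilling lab (diagram β) δ T})
      (T₂ : {T // IsFilling lab (skewDiagram α β) γ T}), ∀ p ∈ diagram α,
      (glue α β δ.len T₁ T₂ p < δ.len ↔ p ∈ diagram β) := by
    intro β T₁ T₂ p hp
    rw [glue]
    split_ifs with h1
    · exact iff_of_true (T₁.2.lt_len h1) h1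
    · exact iff_of_false (by omega) h1
  have glue_fst : ∀ (β : subComps α) (T₁ : {T // IsFilling lab (diagram β) δ T})
      (T₂ : {T // IsFilling lab (skewDiagram α β) γ T}),
      (fun p => if p ∈ diagram β then glue α β δ.len T₁ T₂ p else 0) = T₁.1 := by
    intro β T₁ T₂
    funext p
    rw [glue]
    split_ifs with h1
    · rfl
    · exact (T₁.2.1 p h1).symm
  have glue_snd : ∀ (β : subComps α) (T₁ : {T // IsFilling lab (diagram β) δ T})
      (T₂ : {T // IsFilling lab (skewDiagram α β) γ T}),
      (fun p => if p ∈ skewDiagram α β then glue α β δ.len T₁ T₂ p - δ.len else 0) = T₂.1 := by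
    intro β T₁ T₂
    funext p
    split_ifs with h1
    · obtain ⟨h2, h3⟩ := Finset.mem_sdiff.1 h1
      rw [glue, if_neg h3, if_pos h2, Nat.add_sub_cancel_left]
    · exact (T₂.2.1 p h1).symm
  refine Nat.card_congr (Equiv.ofBijective
    (fun x => ⟨glue α x.1 δ.len x.2.1 x.2.2, ?_⟩) ⟨?_, ?_⟩)
  · obtain ⟨β, T₁, T₂⟩ := x
    have hβ := mem_subComps.1 β.2
    refine (isFilling_glue_iff hβ ?_ (glue_iff β T₁ T₂)).2 ⟨?_, ?_⟩
    · intro p hp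
      rw [glue, if_neg (fun h1 => hp ((contained_iff _ _).1 hβ h1)), if_neg hp]
    · rw [glue_fst]
      exact T₁.2
    · rw [glue_snd]
      exact T₂.2
  · rintro ⟨β, T₁, T₂⟩ ⟨β', T₁', T₂'⟩ hxx
    have hxx' : glue α β δ.len T₁ T₂ = glue α β' δ.len T₁' T₂' := congrArg Subtype.val hxx
    obtain rfl : β = β' := by
      refine Subtype.ext (diagram_injective ?_)
      ext p
      by_cases hp : p ∈ diagram α
      · rw [← glue_iff β T₁ T₂ p hp, hxx', glue_iff β' T₁' T₂' p hp]
      · exact iff_of_false (fun h1 => hp ((contained_iff _ _).1 (mem_subComps.1 β.2) h1))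
          (fun h1 => hp ((contained_iff _ _).1 (mem_subComps.1 β'.2) h1))
    have e1 : T₁ = T₁' := Subtype.ext (by rw [← glue_fst β T₁ T₂, hxx', glue_fst])
    have e2 : T₂ = T₂' := Subtype.ext (by rw [← glue_snd β T₁ T₂, hxx', glue_snd])
    rw [e1, e2]
  · rintro ⟨T, hT⟩
    obtain ⟨β, hβ⟩ := exists_diagram_eq ((diagram α).filter fun p => T p < δ.len) (by
      intro p q hpq hq
      rw [Finset.mem_filter] at hq ⊢
      have hp := mem_diagram_of_cellRel hpq hq.1
      exact ⟨hp, (hT.2.1 p hp q hq.1 hpq).1.trans_lt hq.2⟩)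
    have hβα : Comp.Contained β α := by
      rw [contained_iff, hβ]
      exact Finset.filter_subset _ _
    have h1 := (isFilling_glue_iff hβα hT.1 fun p hp => by
      rw [hβ, Finset.mem_filter, and_iff_right hp]).1 hT
    refine ⟨⟨⟨β, mem_subComps.2 hβα⟩, ⟨_, h1.1⟩, ⟨_, h1.2⟩⟩, Subtype.ext (funext fun p => ?_)⟩
    dsimp only [glue]
    by_cases hp : p ∈ diagram β
    · rw [if_pos hp, if_pos hp]
    · rw [if_neg hp]
      by_cases hpα : p ∈ diagram α
      · have h2 : p ∈ skewDiagram α β := Finset.mem_sdiff.2 ⟨hpα, hp⟩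
        rw [if_pos hpα, if_pos h2]
        rw [hβ, Finset.mem_filter, and_iff_right hpα] at hp
        omega
      · rw [if_neg hpα, hT.1 p hpα]

/-- The coproduct of the generating function of the fillings of `α`: a filling splits into its
small entries, which fill a composition `β ⊆ α`, and its large entries, which fill `α/β`. -/
theorem coeffAt_appendComp_cellGen (lab : ℕ × ℕ → Λ) (α δ γ : Comp) :
    coeffAt (appendComp δ γ) (cellGen (diagram α) lab) =
      ∑ β ∈ subComps α, coeffAt δ (cellGen (diagram β) lab) *
        coeffAt γ (cellGen (skewDiagram α β) lab) := by
  simp only [coeffAt_cellGen, card_isFilling_append]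
  push_cast
  rfl

end Labelled

/-! ### Linear independence of the dual immaculate functions -/

section Dominance

/-- The sum of the first `r` parts. -/
def psum (c : Comp) (r : ℕ) : ℕ := ∑ x ∈ Finset.range r, c.part x

theorem card_filter_lt {D : Finset (ℕ × ℕ)} {c : Comp} {T : ℕ × ℕ → ℕ}
    (hT : ∀ x, (D.filter fun p => T p = x).card = c.part x) (r : ℕ) :
    (D.filter fun p => T p < r).card = psum c r := by
  rw [psum, Finset.card_eq_sum_card_fiberwise (f := T) (t := Finset.range r)]
  · refine Finset.sum_congr rfl fun x hx => ?_
    rw [Finset.filter_filter, ← hT x]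
    refine congrArg Finset.card (Finset.filter_congr fun p _ => ?_)
    rw [Finset.mem_range] at hx
    omega
  · intro p hp
    simpa using (Finset.mem_filter.1 hp).2

/-- The entries in row `r` of an immaculate tableau are at least `r`. -/
theorem IsFilling.row_le {α c : Comp} {T : ℕ × ℕ → ℕ}
    (hT : IsFilling (OrderDual.toDual ∘ cellLab) (diagram α) c T) {r j : ℕ}
    (hp : (r, j) ∈ diagram α) : r ≤ T (r, j) := by
  have col : ∀ r, (r, 0) ∈ diagram α → r ≤ T (r, 0) := by
    intro r
    induction r with
    | zero => exact fun _ => Nat.zero_le _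
    | succ r ih =>
      intro hr
      have hrel : cellRel (r, 0) (r + 1, 0) := Or.inr ⟨rfl, rfl, Nat.lt_succ_self r⟩
      have hr' := mem_diagram_of_cellRel hrel hr
      have h1 := (hT.2.1 _ hr' _ hr hrel).2
        (OrderDual.toDual_lt_toDual.2 (cellLab_lt.2 (Or.inl (Nat.lt_succ_self r))))
      have h2 := ih hr'
      omega
  rcases Nat.eq_zero_or_pos j with rfl | hj
  · exact col r hp
  · have hrel : cellRel (r, 0) (r, j) := Or.inl ⟨rfl, hj⟩
    have hr' := mem_diagram_of_cellRel hrel hp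
    exact (col r hr').trans (hT.2.1 _ hr' _ hp hrel).1

/-- Triangularity of the dual immaculate functions with respect to the dominance order. -/
theorem psum_le_of_coeffAt_ne_zero {α c : Comp} (hc : coeffAt c (dualImmaculate α) ≠ 0) (r : ℕ) :
    psum c r ≤ psum α r := by
  rw [dualImmaculate_eq, coeffAt_cellGen, Nat.cast_ne_zero] at hc
  obtain ⟨⟨T, hT⟩⟩ := (Nat.card_ne_zero.1 hc).1
  rw [← card_filter_lt hT.2.2, ← card_filter_lt (card_row_diagram α)]
  refine Finset.card_le_card fun p hp => ?_
  rw [Finset.mem_filter] at hp ⊢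
  exact ⟨hp.1, (hT.row_le hp.1).trans_lt hp.2⟩

theorem coeffAt_dualImmaculate_self (α : Comp) : coeffAt α (dualImmaculate α) ≠ 0 := by
  rw [dualImmaculate_eq, coeffAt_cellGen, Nat.cast_ne_zero, Nat.card_ne_zero]
  -- row `r` is filled with the entry `r`
  refine ⟨⟨⟨fun p => if p ∈ diagram α then p.1 else 0, fun p hp => if_neg hp, ?_, ?_⟩⟩,
    finite_isFilling _ _ _⟩
  · intro p hp q hq hpq
    dsimp only
    rw [if_pos hp, if_pos hq]
    rcases hpq with ⟨h1, h2⟩ | ⟨h1, h2, h3⟩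
    · refine ⟨h1.le, fun h4 => ?_⟩
      have h5 := cellLab_lt.1 (OrderDual.toDual_lt_toDual.1 h4)
      omega
    · exact ⟨h3.le, fun _ => h3⟩
  · intro x
    rw [← card_row_diagram]
    exact congrArg Finset.card (Finset.filter_congr fun p hp => by dsimp only; rw [if_pos hp])

theorem coeffAt_dualImmaculate_of_size_ne {c α : Comp} (hs : c.size ≠ α.size) :
    coeffAt c (dualImmaculate α) = 0 := by
  rw [dualImmaculate_eq]
  exact coeffAt_ppGen_of_size_ne _ _ (by rwa [Fintype.card_coe, card_diagram])

theorem coeffAt_rsDualImmaculate_of_size_ne {c α : Comp} (hs : c.size ≠ α.size) :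
    coeffAt c (rsDualImmaculate α) = 0 := by
  rw [rsDualImmaculate_eq]
  exact coeffAt_ppGen_of_size_ne _ _ (by rwa [Fintype.card_coe, card_diagram])

/-- The sum of all `psum α r` is strictly monotone for the dominance order. -/
theorem eq_of_sum_psum_le {α c : Comp} (hs : c.size = α.size)
    (hd : ∀ r, psum c r ≤ psum α r)
    (hle : ∑ r ∈ Finset.range (α.size + 1), psum α r ≤
      ∑ r ∈ Finset.range (c.size + 1), psum c r) : c = α := by
  rw [hs] at hle
  have heq := (Finset.sum_eq_sum_iff_of_le (fun r _ => hd r)).1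
    (le_antisymm (Finset.sum_le_sum fun r _ => hd r) hle)
  refine comp_ext fun r => ?_
  by_cases hr : r < α.size
  · have h1 := heq r (Finset.mem_range.2 (by omega))
    have h2 := heq (r + 1) (Finset.mem_range.2 (by omega))
    rw [psum, psum, Finset.sum_range_succ, Finset.sum_range_succ] at h2
    rw [psum, psum] at h1
    omega
  · have h1 := c.2.length_le
    have h2 := α.2.length_le
    dsimp only [Comp.size] at hs hr
    rw [Nat.eq_zero_of_not_pos (mt (part_pos_iff c r).1 (by dsimp only [Comp.len]; omega)),
      Nat.eq_zero_of_not_pos (mt (part_pos_iff α r).1 (by dsimp only [Comp.len]; omega))]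

theorem linearIndependent_dualImmaculate : LinearIndependent ℚ dualImmaculate := by
  rw [linearIndependent_iff]
  intro l hl
  by_contra hne
  obtain ⟨γ, hγ, hmax⟩ := Finset.exists_max_image l.support
    (fun c => ∑ r ∈ Finset.range (c.size + 1), psum c r) (Finsupp.support_nonempty_iff.2 hne)
  have h1 := congrArg (coeffAt γ) hl
  rw [Finsupp.linearCombination_apply, Finsupp.sum, map_sum, map_zero,
    Finset.sum_eq_single γ] at h1
  · rw [map_smul, smul_eq_mul] at h1
    exact (mul_ne_zero (Finsupp.mem_support_iff.1 hγ) (coeffAt_dualImmaculate_self γ)) h1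
  · intro α hα hαγ
    rw [map_smul]
    by_contra h2
    have h3 : coeffAt γ (dualImmaculate α) ≠ 0 := fun h3 => h2 (by rw [h3, smul_zero])
    have hs : γ.size = α.size := by
      by_contra hs
      exact h3 (coeffAt_dualImmaculate_of_size_ne hs)
    exact hαγ (eq_of_sum_psum_le hs (psum_le_of_coeffAt_ne_zero h3) (hmax α hα)).symm
  · exact fun h2 => absurd hγ h2

theorem linearIndependent_rsDualImmaculate : LinearIndependent ℚ rsDualImmaculate := by
  have h1 := linearIndependent_dualImmaculate.map' psi (LinearMap.ker_eq_bot.2 psi_injective)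
  rwa [show psi ∘ dualImmaculate = rsDualImmaculate from funext psi_dualImmaculate] at h1

end Dominance

/-! ### Dual families and expansions -/

theorem span_h : Submodule.span ℚ (Set.range h) = ⊤ := by
  refine top_le_iff.1 ((FreeAlgebra.basisFreeMonoid ℚ ℕ+).span_eq.ge.trans
    (Submodule.span_mono ?_))
  rintro _ ⟨w, rfl⟩
  exact ⟨wordComp w, h_wordComp w⟩

theorem span_M : ⊤ ≤ Submodule.span ℚ (Set.range M) := by
  refine F_span.trans (Submodule.span_le.2 ?_)
  rintro _ ⟨γ, rfl⟩
  rw [F_eq_sum_M]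
  refine Submodule.sum_mem _ fun δ _ => ?_
  split_ifs
  · exact Submodule.subset_span ⟨_, rfl⟩
  · exact Submodule.zero_mem _

/-- Elements of `NSym` are separated by the monomial functions. -/
theorem pairing_injective : Function.Injective pairing := by
  set b := FreeAlgebra.basisFreeMonoid ℚ ℕ+ with hb
  have hinj : Function.Injective wordComp := fun w w' hw =>
    b.injective (by rw [← h_wordComp, ← h_wordComp, hw])
  have key : ∀ w, pairing.flip (M (wordComp w)) = b.coord w := fun w => by
    refine b.ext fun w' => ?_
    rw [LinearMap.flip_apply, ← h_wordComp, pairing_h_M, h_wordComp, ← hb, b.coord_apply,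
      b.repr_self, Finsupp.single_apply]
    simp only [hinj.eq_iff]
  intro g g' hg
  refine b.ext_elem fun w => ?_
  have h1 := LinearMap.congr_fun (key w) g
  have h2 := LinearMap.congr_fun (key w) g'
  rw [LinearMap.flip_apply, b.coord_apply] at h1 h2
  rw [← h1, ← h2, hg]

/-- The coefficients of the members of degree `n` of a family in `QSym`. -/
noncomputable def coeffMatrix (B : Comp → QSym) (n : ℕ) :
    Matrix (Composition n) (Composition n) ℚ :=
  fun α c => coeffAt ⟨n, c⟩ (B ⟨n, α⟩)

theorem isUnit_coeffMatrix {B : Comp → QSym}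
    (hom : ∀ c α : Comp, c.size ≠ α.size → coeffAt c (B α) = 0) (hli : LinearIndependent ℚ B) (n : ℕ) :
    IsUnit (coeffMatrix B n) := by
  rw [← Matrix.linearIndependent_rows_iff_isUnit, Fintype.linearIndependent_iff]
  intro v hv
  refine Fintype.linearIndependent_iff.1
    (hli.comp (fun α : Composition n => (⟨n, α⟩ : Comp)) fun α α' hα =>
      eq_of_heq (Sigma.mk.inj hα).2) v (qsym_ext fun c => ?_)
  rw [map_sum, map_zero]
  by_cases hc : c.size = n
  · obtain ⟨m, c⟩ := c
    obtain rfl : m = n := hc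
    have := congrFun hv c
    simpa [coeffMatrix, Matrix.row] using this
  · refine Finset.sum_eq_zero fun α _ => ?_
    rw [map_smul, Function.comp_apply, hom _ _ hc, smul_zero]

theorem span_of_homogeneous {B : Comp → QSym}
    (hom : ∀ c α : Comp, c.size ≠ α.size → coeffAt c (B α) = 0) (hli : LinearIndependent ℚ B) :
    ⊤ ≤ Submodule.span ℚ (Set.range B) := by
  refine span_M.trans (Submodule.span_le.2 ?_)
  rintro _ ⟨⟨n, γ⟩, rfl⟩
  have hA := (Matrix.isUnit_iff_isUnit_det _).1 (isUnit_coeffMatrix hom hli n)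
  have hM : M ⟨n, γ⟩ = ∑ α : Composition n, (coeffMatrix B n)⁻¹ γ α • B ⟨n, α⟩ := by
    refine qsym_ext fun c => ?_
    rw [map_sum, coeffAt_M]
    by_cases hc : c.size = n
    · obtain ⟨m, c⟩ := c
      obtain rfl : m = n := hc
      have h1 := congrFun (congrFun (Matrix.nonsing_inv_mul _ hA) γ) c
      rw [Matrix.mul_apply, Matrix.one_apply] at h1
      simp only [map_smul, smul_eq_mul]
      refine Eq.trans ?_ h1.symm
      simp
    · rw [if_neg (fun h1 => hc (by rw [← h1])), Finset.sum_eq_zero]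
      intro α _
      rw [map_smul, hom _ _ hc, smul_zero]
  rw [hM]
  exact Submodule.sum_mem _ fun α _ => Submodule.smul_mem _ _ (Submodule.subset_span ⟨_, rfl⟩)

/-- The dual elements are given by the columns of the inverse of the coefficient matrix. -/
theorem exists_isDualTo {B : Comp → QSym}
    (hom : ∀ c α : Comp, c.size ≠ α.size → coeffAt c (B α) = 0) (hli : LinearIndependent ℚ B) (δ : Comp) :
    ∃ g : NSym, IsDualTo B δ g := by
  obtain ⟨n, δ⟩ := δ
  have hA := (Matrix.isUnit_iff_isUnit_det _).1 (isUnit_coeffMatrix hom hli n)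
  refine ⟨∑ c : Composition n, (coeffMatrix B n)⁻¹ c δ • h ⟨n, c⟩, fun α => ?_⟩
  simp only [map_sum, map_smul, LinearMap.sum_apply, LinearMap.smul_apply, pairing_h,
    smul_eq_mul]
  by_cases hc : α.size = n
  · obtain ⟨m, α⟩ := α
    obtain rfl : m = n := hc
    have h1 := congrFun (congrFun (Matrix.mul_nonsing_inv _ hA) α) δ
    rw [Matrix.mul_apply, Matrix.one_apply] at h1
    refine Eq.trans (Finset.sum_congr rfl fun c _ => mul_comm _ _) (h1.trans ?_)
    simp
  · rw [if_neg (fun h1 => hc (by rw [h1])), Finset.sum_eq_zero]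
    intro c _
    rw [hom _ _ (fun h1 => hc h1.symm), mul_zero]

theorem existsUnique_isDualTo {B : Comp → QSym}
    (hom : ∀ c α : Comp, c.size ≠ α.size → coeffAt c (B α) = 0) (hli : LinearIndependent ℚ B) (δ : Comp) :
    ∃! g : NSym, IsDualTo B δ g := by
  obtain ⟨g, hg⟩ := exists_isDualTo hom hli δ
  refine ⟨g, hg, fun g' hg' => pairing_injective ?_⟩
  refine LinearMap.ext_on (top_le_iff.1 (span_of_homogeneous hom hli)) ?_
  rintro _ ⟨α, rfl⟩
  rw [hg α, hg' α]

/-- The expansion of a quasisymmetric function in a family that has a dual family. -/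
theorem isFinSum_of_isDualTo {B : Comp → QSym} (hspan : ⊤ ≤ Submodule.span ℚ (Set.range B))
    {g : Comp → NSym} (hg : ∀ γ, IsDualTo B γ (g γ)) (f : QSym) :
    IsFinSum (fun γ => pairing (g γ) f • B γ) f := by
  obtain ⟨l, rfl⟩ := (Finsupp.mem_span_range_iff_exists_finsupp).1
    (hspan (Submodule.mem_top (x := f)))
  have hl : ∀ γ, pairing (g γ) (l.sum fun i a => a • B i) = l γ := fun γ => by
    rw [Finsupp.sum, map_sum]
    simp only [map_smul, hg γ _, smul_eq_mul, mul_ite, mul_one, mul_zero]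
    simpa using Eq.symm
  simp only [hl]
  have hsub : (Function.support fun γ => l γ • B γ) ⊆ (l.support : Set Comp) := fun γ hγ => by
    rw [Finset.mem_coe, Finsupp.mem_support_iff]
    intro h0
    exact hγ (by simp [h0])
  exact ⟨l.support.finite_toSet.subset hsub, finsum_eq_sum_of_support_subset _ hsub⟩

theorem isDualTo_M_h (γ : Comp) : IsDualTo M γ (h γ) := fun α => by
  rw [pairing_h_M]
  simp only [eq_comm]

theorem card_descSet (c : Comp) : c.descSet.card = c.len - 1 := by
  rw [Comp.descSet, Finset.card_image_of_injOn, Nat.card_Icc, Nat.add_sub_cancel]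
  intro r hr s hs hrs
  rw [Finset.coe_Icc, Set.mem_Icc] at hr hs
  by_contra hne
  rcases lt_or_gt_of_ne hne with h1 | h1
  · have h2 := c.2.sizeUpTo_strict_mono (i := r) (by omega)
    have h3 := c.2.monotone_sizeUpTo (show r + 1 ≤ s from h1)
    omega
  · have h2 := c.2.sizeUpTo_strict_mono (i := s) (by omega)
    have h3 := c.2.monotone_sizeUpTo (show s + 1 ≤ r from h1)
    omega

theorem len_sub_len {α β : Comp} (hs : α.size = β.size) :
    α.len - β.len = α.descSet.card - β.descSet.card := by
  rw [card_descSet, card_descSet]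
  rcases Nat.eq_zero_or_pos β.size with h0 | h0
  · have h1 := α.2.length_le
    dsimp only [Comp.size, Comp.len] at *
    omega
  · have h1 := β.2.length_pos_of_pos h0
    dsimp only [Comp.len]
    omega

/-- The ribbons are dual to the fundamental functions: Möbius inversion in the Boolean lattice. -/
theorem isDualTo_F_ribbon (γ : Comp) : IsDualTo F γ (ribbon γ) := by
  intro δ
  have e1 : pairing (ribbon γ) (F δ) = ∑ β : Composition γ.size,
      if δ.size = γ.size ∧ δ.descSet ⊆ Comp.descSet ⟨γ.size, β⟩ ∧
        Comp.descSet ⟨γ.size, β⟩ ⊆ γ.descSet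
      then (-1 : ℚ) ^ (γ.descSet \ Comp.descSet ⟨γ.size, β⟩).card else 0 := by
    rw [ribbon, map_sum, LinearMap.sum_apply]
    refine Finset.sum_congr rfl fun β _ => ?_
    by_cases h1 : Comp.Coarsens ⟨γ.size, β⟩ γ
    · rw [if_pos h1, map_smul, LinearMap.smul_apply, pairing_h, coeffAt_F, smul_eq_mul, mul_ite,
        mul_one, mul_zero, Finset.card_sdiff_of_subset h1.2,
        ← len_sub_len (α := γ) (β := ⟨γ.size, β⟩) rfl]
      refine if_congr ?_ rfl rfl
      exact ⟨fun h2 => ⟨h2.1, h2.2, h1.2⟩, fun h2 => ⟨h2.1, h2.2.1⟩⟩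
    · rw [if_neg h1, map_zero, LinearMap.zero_apply, if_neg]
      exact fun h2 => h1 ⟨rfl, h2.2.2⟩
  rw [e1]
  by_cases h1 : δ.size = γ.size ∧ δ.descSet ⊆ γ.descSet
  · rw [← Finset.sum_filter]
    have e2 := Finset.sum_powerset_neg_one_pow_card (x := γ.descSet \ δ.descSet)
    have e3 : (∑ m ∈ (γ.descSet \ δ.descSet).powerset, (-1 : ℚ) ^ m.card) =
        if γ.descSet \ δ.descSet = ∅ then 1 else 0 := by exact_mod_cast congrArg (Int.cast : ℤ → ℚ) e2
    have e4 : γ.descSet \ δ.descSet = ∅ ↔ δ = γ := by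
      rw [Finset.sdiff_eq_empty_iff_subset]
      exact ⟨fun h2 => eq_of_descSet_eq h1.1 (h1.2.antisymm h2), fun h2 => by rw [h2]⟩
    rw [if_congr e4 rfl rfl] at e3
    rw [← e3]
    have hdesc : ∀ U, (compOf γ.size (γ.descSet \ U)).descSet = γ.descSet \ U := fun U =>
      descSet_compOf _ _ (Finset.sdiff_subset.trans (descSet_subset_Icc γ))
    -- index the compositions between `δ` and `γ` by the elements of `set(γ)` that they omit
    refine Finset.sum_nbij' (fun β => γ.descSet \ Comp.descSet ⟨γ.size, β⟩)
      (fun U => (compOf γ.size (γ.descSet \ U)).2) ?_ ?_ ?_ ?_ ?_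
    · intro β hβ
      exact Finset.mem_powerset.2 (Finset.sdiff_subset_sdiff subset_rfl
        (Finset.mem_filter.1 hβ).2.2.1)
    · intro U hU
      rw [Finset.mem_powerset] at hU
      refine Finset.mem_filter.2 ⟨Finset.mem_univ _, h1.1, ?_⟩
      change _ ⊆ (compOf γ.size (γ.descSet \ U)).descSet ∧
        (compOf γ.size (γ.descSet \ U)).descSet ⊆ _
      rw [hdesc]
      refine ⟨fun d hd => Finset.mem_sdiff.2 ⟨h1.2 hd, fun hdU => ?_⟩, Finset.sdiff_subset⟩
      exact (Finset.mem_sdiff.1 (hU hdU)).2 hd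
    · intro β hβ
      have h2 := (Finset.mem_filter.1 hβ).2.2.2
      have h3 : compOf γ.size (γ.descSet \ (γ.descSet \ Comp.descSet ⟨γ.size, β⟩)) =
          ⟨γ.size, β⟩ := by
        rw [Finset.sdiff_sdiff_eq_self h2]
        exact compOf_descSet ⟨γ.size, β⟩
      exact eq_of_heq (Sigma.mk.inj (h3 : (⟨γ.size, _⟩ : Comp) = ⟨γ.size, β⟩)).2
    · intro U hU
      change γ.descSet \ (compOf γ.size (γ.descSet \ U)).descSet = U
      rw [hdesc, Finset.sdiff_sdiff_eq_self
        ((Finset.mem_powerset.1 hU).trans Finset.sdiff_subset)]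
    · exact fun β _ => rfl
  · rw [if_neg (fun h2 => h1 (by rw [h2]; exact ⟨rfl, subset_rfl⟩)), Finset.sum_eq_zero]
    exact fun β _ => if_neg fun h2 => h1 ⟨h2.1, h2.2.1.trans h2.2.2⟩

/-! ### Skew functions as generating functions -/

theorem h_appendComp (δ γ : Comp) : h (appendComp δ γ) = h δ * h γ := by
  change ((δ.2.blocks ++ γ.2.blocks).map hGen).prod = _
  rw [List.map_append, List.prod_append]
  rfl

theorem pairing_mul_h {Λ : Type} [LinearOrder Λ] (lab : ℕ × ℕ → Λ) (α γ : Comp) (g : NSym) :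
    pairing (g * h γ) (cellGen (diagram α) lab) =
      ∑ β ∈ subComps α, pairing g (cellGen (diagram β) lab) *
        coeffAt γ (cellGen (skewDiagram α β) lab) := by
  have hg : g ∈ Submodule.span ℚ (Set.range h) := span_h ▸ Submodule.mem_top
  induction hg using Submodule.span_induction with
  | mem g hg =>
    obtain ⟨δ, rfl⟩ := hg
    rw [← h_appendComp, pairing_h, pairing_h, coeffAt_appendComp_cellGen]
  | zero => simp
  | add x y _ _ hx hy =>
    rw [add_mul, map_add, map_add, LinearMap.add_apply, hx, hy, ← Finset.sum_add_distrib]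
    exact Finset.sum_congr rfl fun β _ => by rw [LinearMap.add_apply, add_mul]
  | smul a x _ hx =>
    rw [smul_mul_assoc, map_smul, map_smul, LinearMap.smul_apply, hx, smul_eq_mul,
      Finset.mul_sum]
    exact Finset.sum_congr rfl fun β _ => by rw [LinearMap.smul_apply, smul_eq_mul, mul_assoc]

/-- Pairing with a product whose left factor is dual immaculate amounts to pairing the right
factor with the generating function of the skew fillings. -/
theorem pairing_dual_mul {Λ : Type} [LinearOrder Λ] (lab : ℕ × ℕ → Λ) {α β : Comp}
    (hβα : Comp.Contained β α) {g : NSym}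
    (hg : IsDualTo (fun α => cellGen (diagram α) lab) β g) (a : NSym) :
    pairing (g * a) (cellGen (diagram α) lab) = pairing a (cellGen (skewDiagram α β) lab) := by
  have ha : a ∈ Submodule.span ℚ (Set.range h) := span_h ▸ Submodule.mem_top
  induction ha using Submodule.span_induction with
  | mem a ha =>
    obtain ⟨γ, rfl⟩ := ha
    rw [pairing_mul_h, pairing_h, Finset.sum_eq_single β]
    · rw [hg β, if_pos rfl, one_mul]
    · intro β' _ hne
      rw [hg β', if_neg hne, zero_mul]
    · exact fun hn => absurd (mem_subComps.2 hβα) hn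
  | zero => simp
  | add x y _ _ hx hy =>
    rw [mul_add, map_add, map_add, LinearMap.add_apply, hx, hy, LinearMap.add_apply]
  | smul c x _ hx =>
    rw [mul_smul_comm, map_smul, map_smul, LinearMap.smul_apply, hx, LinearMap.smul_apply]

theorem isDualTo_immaculate (β : Comp) : IsDualTo dualImmaculate β (immaculate β) :=
  Classical.epsilon_spec (exists_isDualTo (fun _ _ => coeffAt_dualImmaculate_of_size_ne)
    linearIndependent_dualImmaculate β)

theorem isDualTo_rsImmaculate (β : Comp) : IsDualTo rsDualImmaculate β (rsImmaculate β) :=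
  Classical.epsilon_spec (exists_isDualTo (fun _ _ => coeffAt_rsDualImmaculate_of_size_ne)
    linearIndependent_rsDualImmaculate β)

theorem pairing_immaculate_mul {α β : Comp} (hβα : Comp.Contained β α) (a : NSym) :
    pairing (immaculate β * a) (dualImmaculate α) =
      pairing a (cellGen (skewDiagram α β) (OrderDual.toDual ∘ cellLab)) := by
  rw [dualImmaculate_eq]
  refine pairing_dual_mul _ hβα ?_ a
  rw [← funext dualImmaculate_eq]
  exact isDualTo_immaculate β

theorem pairing_rsImmaculate_mul {α β : Comp} (hβα : Comp.Contained β α) (a : NSym) :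
    pairing (rsImmaculate β * a) (rsDualImmaculate α) =
      pairing a (cellGen (skewDiagram α β) cellLab) := by
  rw [rsDualImmaculate_eq]
  refine pairing_dual_mul _ hβα ?_ a
  rw [← funext rsDualImmaculate_eq]
  exact isDualTo_rsImmaculate β

theorem skewDualImmaculate_eq {α β : Comp} (hβα : Comp.Contained β α) :
    skewDualImmaculate α β =
      cellGen (skewDiagram α β) (OrderDual.toDual ∘ cellLab) := by
  rw [skewDualImmaculate]
  simp only [pairing_immaculate_mul hβα]
  exact (isFinSum_of_isDualTo span_M isDualTo_M_h _).2

theorem skewRsDualImmaculate_eq {α β : Comp} (hβα : Comp.Contained β α) :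
    skewRsDualImmaculate α β = cellGen (skewDiagram α β) cellLab := by
  rw [skewRsDualImmaculate]
  simp only [pairing_rsImmaculate_mul hβα]
  exact (isFinSum_of_isDualTo span_M isDualTo_M_h _).2

/-! ### Standard skew tableaux -/

/-- The linear extensions of the cells of `α/β`. -/
abbrev SkewLinExt (α β : Comp) : Type :=
  LinExt (fun p q : skewDiagram α β => cellRel p.1 q.1) (skewDiagram α β).card

theorem isFinSum_of_bijective {ι κ : Type} [Fintype ι] (t : κ → QSym) {e : ι → κ}
    (he : Function.Bijective e) : IsFinSum t (∑ i, t (e i)) := by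
  have : Finite κ := Finite.of_surjective e he.2
  refine ⟨Set.toFinite _, ?_⟩
  rw [← finsum_eq_sum_of_fintype]
  exact (finsum_comp_equiv (Equiv.ofBijective e he)).symm

variable {α β : Comp}

theorem cellGen_skewDiagram_eq_sum (α β : Comp) :
    cellGen (skewDiagram α β) cellLab = ∑ s : SkewLinExt α β,
      F (compOf (skewDiagram α β).card (desSet (fun p : skewDiagram α β => cellLab p.1) s.1)) :=
  ppGen_eq_sum (fun p => cellRel_irrefl p.1) (cellLab_injective.comp Subtype.val_injective)
    (Fintype.card_coe _)

/-- For an earlier cell `p` and a later cell `q`, the label drops exactly if `q` is weakly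
below `p`, since the entries of a row increase. -/
theorem SkewLinExt.cellLab_lt_iff (s : SkewLinExt α β) {p q : skewDiagram α β}
    (hpq : s.1 p < s.1 q) : cellLab q.1 < cellLab p.1 ↔ q.1.1 ≤ p.1.1 := by
  rw [cellLab_lt]
  refine ⟨fun h1 => by omega, fun h1 => ?_⟩
  rcases h1.lt_or_eq with h1 | h1
  · exact Or.inl h1
  · refine Or.inr ⟨h1, ?_⟩
    by_contra h2
    rcases (not_lt.1 h2).lt_or_eq with h3 | h3
    · exact (s.2 q p (Or.inl ⟨h1, h3⟩)).not_gt hpq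
    · rw [Subtype.ext (Prod.ext h1 h3) (a1 := q)] at hpq
      exact lt_irrefl _ hpq

theorem SkewLinExt.mem_desSet_iff (s : SkewLinExt α β) (d : ℕ) :
    d ∈ desSet (fun p : skewDiagram α β => cellLab p.1) s.1 ↔
      ∃ a b : Fin (skewDiagram α β).card, (b : ℕ) = a + 1 ∧ (b : ℕ) = d ∧
        (s.1.symm b).1.1 ≤ (s.1.symm a).1.1 := by
  have key : ∀ a b : Fin (skewDiagram α β).card, (b : ℕ) = a + 1 →
      (cellLab (s.1.symm b).1 < cellLab (s.1.symm a).1 ↔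
        (s.1.symm b).1.1 ≤ (s.1.symm a).1.1) := fun a b hab =>
    s.cellLab_lt_iff (by
      rw [Equiv.apply_symm_apply, Equiv.apply_symm_apply, Fin.lt_def]
      omega)
  rw [desSet, Finset.mem_filter, Finset.mem_Icc]
  constructor
  · rintro ⟨-, a, b, h1, h2, h3⟩
    exact ⟨a, b, h1, h2, (key a b h1).1 h3⟩
  · rintro ⟨a, b, h1, h2, h3⟩
    exact ⟨by omega, a, b, h1, h2, (key a b h1).2 h3⟩

/-- The standard tableau with entries `1, …, k` of a linear extension. -/
noncomputable def SkewLinExt.toTableau (s : SkewLinExt α β) : SkewTableau α β where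
  entry p := s.1 p + 1
  injective p q hpq := s.1.injective (Fin.ext (Nat.succ_injective hpq))
  range_eq := by
    ext x
    rw [Set.mem_range, Set.mem_Icc]
    constructor
    · rintro ⟨p, rfl⟩
      exact ⟨Nat.le_add_left _ _, (s.1 p).2⟩
    · rintro ⟨h1, h2⟩
      refine ⟨s.1.symm ⟨x - 1, by omega⟩, ?_⟩
      rw [Equiv.apply_symm_apply]
      dsimp only
      omega
  row_lt p q h1 h2 := Nat.succ_lt_succ (s.2 p q (Or.inl ⟨h1, h2⟩))
  col_lt p q h1 h2 h3 := Nat.succ_lt_succ (s.2 p q (Or.inr ⟨h1, h2, h3⟩))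

theorem SkewTableau.ext_entry {T T' : SkewTableau α β} (he : T.entry = T'.entry) : T = T' := by
  cases T
  cases T'
  congr

theorem SkewLinExt.toTableau_bijective :
    Function.Bijective (SkewLinExt.toTableau (α := α) (β := β)) := by
  constructor
  · intro s s' hss
    have h1 := congrArg SkewTableau.entry hss
    refine Subtype.ext (Equiv.ext fun p => Fin.ext ?_)
    exact Nat.succ_injective (congrFun h1 p)
  · intro T
    have hT : ∀ p, T.entry p ∈ Set.Icc 1 (skewDiagram α β).card := fun p =>
      T.range_eq ▸ Set.mem_range_self p
    have hpos : ∀ p, T.entry p - 1 + 1 = T.entry p := fun p => Nat.sub_add_cancel (hT p).1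
    set f : skewDiagram α β → Fin (skewDiagram α β).card := fun p =>
      ⟨T.entry p - 1, by have := (hT p).1; have := (hT p).2; omega⟩ with hf
    have hfi : Function.Injective f := fun p q hpq => T.injective (by
      have := congrArg Fin.val hpq
      rw [← hpos p, ← hpos q]
      exact congrArg Nat.succ this)
    have hfb : Function.Bijective f :=
      (Fintype.bijective_iff_injective_and_card f).2 ⟨hfi, by simp⟩
    refine ⟨⟨Equiv.ofBijective f hfb, fun p q hpq => ?_⟩, ?_⟩
    · have h1 : T.entry p < T.entry q := by
        rcases hpq with ⟨h1, h2⟩ | ⟨h1, h2, h3⟩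
        · exact T.row_lt p q h1 h2
        · exact T.col_lt p q h1 h2 h3
      have h2 := hpos p
      have h3 := hpos q
      change T.entry p - 1 < T.entry q - 1
      omega
    · exact SkewTableau.ext_entry (funext hpos)

theorem SkewLinExt.rsDes_toTableau (s : SkewLinExt α β) :
    s.toTableau.rsDes = desSet (fun p : skewDiagram α β => cellLab p.1) s.1 := by
  ext d
  rw [s.mem_desSet_iff, SkewTableau.rsDes, Finset.mem_filter, Finset.mem_Icc]
  change (_ ∧ ∃ p q : skewDiagram α β, (s.1 p : ℕ) + 1 = d ∧ (s.1 q : ℕ) + 1 = d + 1 ∧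
    q.1.1 ≤ p.1.1) ↔ _
  constructor
  · rintro ⟨-, p, q, h1, h2, h3⟩
    refine ⟨s.1 p, s.1 q, by omega, by omega, ?_⟩
    rwa [Equiv.symm_apply_apply, Equiv.symm_apply_apply]
  · rintro ⟨a, b, h1, h2, h3⟩
    refine ⟨by omega, s.1.symm a, s.1.symm b, ?_, ?_, h3⟩
    · rw [Equiv.apply_symm_apply]
      omega
    · rw [Equiv.apply_symm_apply]
      omega

/-! ### Paths -/

/-- A cell that extends one diagram to another lies at the end of a row. -/
theorem row_end_of_insert {a b : Comp} {q : ℕ × ℕ} (hq : q ∉ diagram b)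
    (hab : diagram a = insert q (diagram b)) : q = (q.1, b.part q.1) := by
  refine Prod.ext rfl (le_antisymm (not_lt.1 fun h1 => ?_) (not_lt.1 fun h1 => ?_))
  · have h2 : (q.1, b.part q.1) ∈ diagram a :=
      mem_diagram_of_cellRel (q := q) (Or.inl ⟨rfl, h1⟩) (by
        rw [hab]
        exact Finset.mem_insert_self _ _)
    rw [hab, Finset.mem_insert] at h2
    rcases h2 with h2 | h2
    · rw [← h2] at h1
      exact lt_irrefl _ h1
    · rw [mem_diagram] at h2
      exact lt_irrefl _ h2
  · exact hq ((mem_diagram b q).2 h1)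

theorem row_end_notMem (b : Comp) (m : ℕ) : (m, b.part m) ∉ diagram b := fun h1 =>
  lt_irrefl _ ((mem_diagram b _).1 h1)

/-- Covers add one cell at the end of a row, possibly of the first empty row. -/
theorem cover_iff {a b : Comp} {m : ℕ} :
    Cover a b m ↔ diagram a = insert (m, b.part m) (diagram b) := by
  constructor
  · rintro ⟨h1, h2, -, h4⟩
    symm
    refine Finset.eq_of_subset_of_card_le ?_ ?_
    · refine Finset.insert_subset ?_ ((contained_iff b a).1 h2)
      rw [mem_diagram, h4]
      exact Nat.lt_succ_self _
    · rw [Finset.card_insert_of_notMem (row_end_notMem b m), card_diagram, card_diagram, h1]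
  · intro hab
    have hmem : ∀ r j, j < a.part r ↔ (r = m ∧ j = b.part m) ∨ j < b.part r := fun r j => by
      rw [← mem_diagram a (r, j), hab, Finset.mem_insert, mem_diagram, Prod.mk.injEq]
    refine ⟨?_, ?_, ?_, ?_⟩
    · rw [← card_diagram a, hab, Finset.card_insert_of_notMem (row_end_notMem b m), card_diagram]
    · refine (contained_iff b a).2 ?_
      rw [hab]
      exact Finset.subset_insert _ _
    · by_contra hl
      have hb : ∀ r, b.len ≤ r → b.part r = 0 := fun r hr =>
        Nat.eq_zero_of_not_pos fun h1 => ((part_pos_iff b r).1 h1).not_ge hr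
      have h1 := (hmem b.len 0).1 ((part_pos_iff a _).2 (by omega))
      have h2 := (hmem (b.len + 1) 0).1 ((part_pos_iff a _).2 (by omega))
      rw [hb _ le_rfl] at h1
      rw [hb _ (Nat.le_succ _)] at h2
      omega
    · have h1 := hmem m (b.part m)
      have h2 := hmem m (b.part m + 1)
      omega

theorem Cover.label_unique {a b : Comp} {m m' : ℕ} (h1 : Cover a b m) (h2 : Cover a b m') :
    m = m' := by
  have h3 := cover_iff.1 h2
  rw [cover_iff.1 h1] at h3
  have h4 : (m, b.part m) ∈ insert (m', b.part m') (diagram b) := by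
    rw [← h3]
    exact Finset.mem_insert_self _ _
  rcases Finset.mem_insert.1 h4 with h5 | h5
  · exact (Prod.ext_iff.1 h5).1
  · exact absurd h5 (row_end_notMem b m)

/-- The vertices of a path, extended by `β` beyond its end. -/
noncomputable def Path.vertexAt (P : Path α β) (i : ℕ) : Comp :=
  if hi : i < P.length + 1 then P.vertex ⟨i, hi⟩ else β

theorem Path.ext_vertexAt {P Q : Path α β} (hl : P.length = Q.length)
    (hv : ∀ i ≤ P.length, P.vertexAt i = Q.vertexAt i) : P = Q := by
  obtain ⟨n, v, l, h0, h1, hc⟩ := P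
  obtain ⟨n', v', l', h0', h1', hc'⟩ := Q
  obtain rfl : n = n' := hl
  obtain rfl : v = v' := by
    funext i
    have h2 := hv i (Nat.lt_succ_iff.1 i.2)
    simp only [Path.vertexAt, i.2, dif_pos] at h2
    exact h2
  obtain rfl : l = l' := funext fun i => (hc i).label_unique (hc' i)
  rfl

theorem Path.vertexAt_zero (P : Path α β) : P.vertexAt 0 = α := by
  rw [vertexAt, dif_pos (Nat.succ_pos _)]
  exact P.vertex_zero

theorem Path.vertexAt_length (P : Path α β) : P.vertexAt P.length = β := by
  rw [vertexAt, dif_pos (Nat.lt_succ_self _)]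
  exact P.vertex_last

theorem Path.exists_cell (P : Path α β) {i : ℕ} (hi : i < P.length) :
    ∃ q ∉ diagram (P.vertexAt (i + 1)),
      diagram (P.vertexAt i) = insert q (diagram (P.vertexAt (i + 1))) := by
  have h1 := cover_iff.1 (P.cover ⟨i, hi⟩)
  rw [vertexAt, vertexAt, dif_pos (Nat.succ_lt_succ hi), dif_pos (Nat.lt_succ_of_lt hi)]
  exact ⟨_, row_end_notMem _ _, h1⟩

theorem Path.diagram_antitone (P : Path α β) {i j : ℕ} (hij : i ≤ j) (hj : j ≤ P.length) :
    diagram (P.vertexAt j) ⊆ diagram (P.vertexAt i) := by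
  induction j, hij using Nat.le_induction with
  | base => exact subset_rfl
  | succ j hij ih =>
    obtain ⟨q, -, hq⟩ := P.exists_cell (i := j) (by omega)
    refine subset_trans ?_ (ih (by omega))
    rw [hq]
    exact Finset.subset_insert _ _

theorem Path.card_vertexAt (P : Path α β) {i : ℕ} (hi : i ≤ P.length) :
    (diagram (P.vertexAt i)).card + i = (diagram α).card := by
  induction i with
  | zero => rw [P.vertexAt_zero, add_zero]
  | succ i ih =>
    obtain ⟨q, hq, h1⟩ := P.exists_cell (i := i) (by omega)
    have h2 := ih (by omega)
    rw [h1, Finset.card_insert_of_notMem hq] at h2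
    omega

theorem Path.length_eq (P : Path α β) : P.length = (skewDiagram α β).card := by
  have h1 := P.card_vertexAt le_rfl
  have h2 := P.diagram_antitone (Nat.zero_le _) le_rfl
  rw [P.vertexAt_length] at h1 h2
  rw [P.vertexAt_zero] at h2
  rw [skewDiagram, Finset.card_sdiff_of_subset h2]
  omega

theorem mem_skewDiagram {p : ℕ × ℕ} : p ∈ skewDiagram α β ↔ p ∈ diagram α ∧ p ∉ diagram β :=
  Finset.mem_sdiff

theorem SkewLinExt.exists_stage (s : SkewLinExt α β) (m : ℕ) : ∃ γ : Comp, diagram γ =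
    (diagram α ∪ diagram β).filter
      fun p => p ∈ diagram β ∨ ∃ hp : p ∈ skewDiagram α β, (s.1 ⟨p, hp⟩ : ℕ) < m := by
  refine exists_diagram_eq _ fun p q hpq hq => ?_
  rw [Finset.mem_filter] at hq ⊢
  rcases hq.2 with h1 | ⟨h1, h2⟩
  · have h3 := mem_diagram_of_cellRel hpq h1
    exact ⟨Finset.mem_union_right _ h3, Or.inl h3⟩
  · have h3 := mem_diagram_of_cellRel hpq (mem_skewDiagram.1 h1).1
    refine ⟨Finset.mem_union_left _ h3, or_iff_not_imp_left.2 fun h4 => ?_⟩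
    have h5 : p ∈ skewDiagram α β := mem_skewDiagram.2 ⟨h3, h4⟩
    exact ⟨h5, lt_trans (s.2 ⟨p, h5⟩ ⟨q, h1⟩ hpq) h2⟩

/-- The composition obtained from `β` by adding the first `m` cells of a linear extension. -/
noncomputable def SkewLinExt.stage (s : SkewLinExt α β) (m : ℕ) : Comp :=
  (s.exists_stage m).choose

theorem SkewLinExt.mem_stage (s : SkewLinExt α β) (m : ℕ) (p : ℕ × ℕ) :
    p ∈ diagram (s.stage m) ↔
      p ∈ diagram β ∨ ∃ hp : p ∈ skewDiagram α β, (s.1 ⟨p, hp⟩ : ℕ) < m := by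
  rw [SkewLinExt.stage, (s.exists_stage m).choose_spec, Finset.mem_filter,
    and_iff_right_of_imp]
  rintro (h1 | ⟨h1, -⟩)
  · exact Finset.mem_union_right _ h1
  · exact Finset.mem_union_left _ (mem_skewDiagram.1 h1).1

theorem SkewLinExt.cover_stage (s : SkewLinExt α β) {m : ℕ} (hm : m < (skewDiagram α β).card) :
    Cover (s.stage (m + 1)) (s.stage m) (s.1.symm ⟨m, hm⟩).1.1 := by
  set q := s.1.symm ⟨m, hm⟩ with hq
  have hsq : s.1 q = ⟨m, hm⟩ := Equiv.apply_symm_apply _ _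
  have h1 : q.1 ∉ diagram (s.stage m) := by
    rw [s.mem_stage]
    rintro (h1 | ⟨h1, h2⟩)
    · exact (mem_skewDiagram.1 q.2).2 h1
    · rw [hsq] at h2
      exact lt_irrefl _ h2
  have h2 : diagram (s.stage (m + 1)) = insert q.1 (diagram (s.stage m)) := by
    ext p
    rw [Finset.mem_insert, s.mem_stage, s.mem_stage]
    constructor
    · rintro (h2 | ⟨h2, h3⟩)
      · exact Or.inr (Or.inl h2)
      · rcases (Nat.lt_succ_iff.1 h3).lt_or_eq with h4 | h4
        · exact Or.inr (Or.inr ⟨h2, h4⟩)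
        · refine Or.inl (congrArg Subtype.val (s.1.injective (a₁ := ⟨p, h2⟩) ?_))
          rw [hsq]
          exact Fin.ext h4
    · rintro (rfl | h2 | ⟨h2, h3⟩)
      · refine Or.inr ⟨q.2, ?_⟩
        rw [hsq]
        exact Nat.lt_succ_self m
      · exact Or.inl h2
      · exact Or.inr ⟨h2, Nat.lt_succ_of_lt h3⟩
  rw [cover_iff, ← row_end_of_insert h1 h2, h2]

/-- The path from `α` to `β` that removes the cells in the reverse order of a linear extension. -/
noncomputable def SkewLinExt.toPath (hβα : Comp.Contained β α) (s : SkewLinExt α β) :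
    Path α β where
  length := (skewDiagram α β).card
  vertex i := s.stage ((skewDiagram α β).card - i)
  label i := (s.1.symm i.rev).1.1
  vertex_zero := diagram_injective (by
    ext p
    rw [s.mem_stage]
    constructor
    · rintro (h1 | ⟨h1, -⟩)
      · exact (contained_iff β α).1 hβα h1
      · exact (mem_skewDiagram.1 h1).1
    · exact fun h1 => or_iff_not_imp_left.2 fun h2 =>
        ⟨mem_skewDiagram.2 ⟨h1, h2⟩, by simp⟩)
  vertex_last := diagram_injective (by
    ext p
    rw [s.mem_stage]
    simp)
  cover i := by
    have h1 := s.cover_stage i.rev.2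
    have h2 : (i.rev : ℕ) = (skewDiagram α β).card - i.succ := by
      rw [Fin.val_rev, Fin.val_succ]
    have h3 : (i.rev : ℕ) + 1 = (skewDiagram α β).card - i.castSucc := by
      rw [Fin.val_rev, Fin.val_castSucc]
      omega
    rw [← h2, ← h3]
    exact h1

theorem SkewLinExt.vertexAt_toPath (hβα : Comp.Contained β α) (s : SkewLinExt α β) {i : ℕ}
    (hi : i ≤ (skewDiagram α β).card) :
    (s.toPath hβα).vertexAt i = s.stage ((skewDiagram α β).card - i) :=
  dif_pos (Nat.lt_succ_of_le hi)

theorem SkewLinExt.toPath_injective (hβα : Comp.Contained β α) :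
    Function.Injective (SkewLinExt.toPath hβα) := by
  intro s s' hss
  have hstage : ∀ m ≤ (skewDiagram α β).card, s.stage m = s'.stage m := fun m hm => by
    have h1 := congrArg (fun P => P.vertexAt ((skewDiagram α β).card - m)) hss
    rw [vertexAt_toPath _ _ (Nat.sub_le _ _), vertexAt_toPath _ _ (Nat.sub_le _ _),
      Nat.sub_sub_self hm] at h1
    exact h1
  have key : ∀ (p : skewDiagram α β), ∀ m ≤ (skewDiagram α β).card,
      ((s.1 p : ℕ) < m ↔ (s'.1 p : ℕ) < m) := fun p m hm => by
    have h1 : ∀ u : SkewLinExt α β, p.1 ∈ diagram (u.stage m) ↔ (u.1 p : ℕ) < m := fun u => by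
      rw [u.mem_stage, or_iff_right (mem_skewDiagram.1 p.2).2]
      exact ⟨fun ⟨_, h2⟩ => h2, fun h2 => ⟨p.2, h2⟩⟩
    rw [← h1, ← h1, hstage m hm]
  refine Subtype.ext (Equiv.ext fun p => Fin.ext ?_)
  have h1 := key p (s.1 p + 1) (s.1 p).2
  have h2 := key p (s'.1 p + 1) (s'.1 p).2
  omega

theorem SkewLinExt.toPath_surjective (hβα : Comp.Contained β α) :
    Function.Surjective (SkewLinExt.toPath hβα) := by
  intro P
  have hlen := P.length_eq
  set n := (skewDiagram α β).card with hn
  -- `q i` is the cell that the step with index `i` removes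
  choose q hq1 hq2 using fun i : Fin P.length => P.exists_cell i.2
  have hqmem : ∀ i : Fin P.length, q i ∈ diagram (P.vertexAt i) := fun i => by
    rw [hq2 i]
    exact Finset.mem_insert_self _ _
  have hq_mem_iff : ∀ (i : Fin P.length) (j : ℕ), j ≤ P.length →
      (q i ∈ diagram (P.vertexAt j) ↔ j ≤ i) := fun i j hj => by
    refine ⟨fun h1 => not_lt.1 fun h2 => hq1 i (P.diagram_antitone h2 hj h1),
      fun h1 => P.diagram_antitone h1 i.2.le (hqmem i)⟩
  have hskew : ∀ i, q i ∈ skewDiagram α β := fun i => by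
    have h1 := (hq_mem_iff i 0 (Nat.zero_le _)).2 (Nat.zero_le _)
    have h2 := mt (hq_mem_iff i _ le_rfl).1 (not_le.2 i.2)
    rw [P.vertexAt_zero] at h1
    rw [P.vertexAt_length] at h2
    exact mem_skewDiagram.2 ⟨h1, h2⟩
  set u : Fin n → skewDiagram α β := fun j =>
    ⟨q (Fin.cast hlen.symm j.rev), hskew _⟩ with hu
  have hmem : ∀ (j : Fin n) (i : ℕ), i ≤ n →
      ((u j).1 ∈ diagram (P.vertexAt i) ↔ (j : ℕ) < n - i) := fun j i hi => by
    rw [hu, hq_mem_iff _ _ (hlen ▸ hi), Fin.val_cast, Fin.val_rev]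
    omega
  have hui : Function.Injective u := by
    intro a b hab
    have h1 := hmem a (n - 1 - a) (by omega)
    have h2 := hmem b (n - 1 - a) (by omega)
    have h3 := hmem a (n - 1 - b) (by omega)
    have h4 := hmem b (n - 1 - b) (by omega)
    rw [hab] at h1 h3
    have h5 := h1.symm.trans h2
    have h6 := h3.symm.trans h4
    have := a.2
    have := b.2
    apply Fin.ext
    omega
  have hub : Function.Bijective u :=
    (Fintype.bijective_iff_injective_and_card u).2 ⟨hui, by simp [hn]⟩
  set e := Equiv.ofBijective u hub with he
  have hes : ∀ p, u (e.symm p) = p := fun p => e.apply_symm_apply p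
  have hmem' : ∀ (p : skewDiagram α β) (i : ℕ), i ≤ n →
      (p.1 ∈ diagram (P.vertexAt i) ↔ (e.symm p : ℕ) < n - i) := fun p i hi => by
    rw [← hmem _ i hi, hes]
  refine ⟨⟨e.symm, fun p r hpr => ?_⟩, Path.ext_vertexAt hlen.symm fun i hi => ?_⟩
  · have h1 := (hmem' r (n - 1 - e.symm r) (by omega)).2 (by omega)
    have h2 := (hmem' p _ (by omega)).1 (mem_diagram_of_cellRel hpr h1)
    have h3 : e.symm p ≠ e.symm r := fun h3 => by
      rw [e.symm.injective h3] at hpr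
      exact cellRel_irrefl _ hpr
    have h4 := (e.symm r).2
    have h5 := Fin.val_ne_of_ne h3
    rw [Fin.lt_def]
    omega
  · change i ≤ n at hi
    rw [vertexAt_toPath _ _ hi]
    refine diagram_injective (Finset.ext fun p => ?_)
    rw [SkewLinExt.mem_stage]
    have hlow := P.diagram_antitone (hlen ▸ hi) le_rfl
    have hhigh := P.diagram_antitone (Nat.zero_le i) (hlen ▸ hi)
    rw [P.vertexAt_length] at hlow
    rw [P.vertexAt_zero] at hhigh
    constructor
    · rintro (h1 | ⟨h1, h2⟩)
      · exact hlow h1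
      · exact (hmem' ⟨p, h1⟩ i hi).2 h2
    · refine fun h1 => or_iff_not_imp_left.2 fun h2 => ?_
      have h3 := mem_skewDiagram.2 ⟨hhigh h1, h2⟩
      exact ⟨h3, (hmem' ⟨p, h3⟩ i hi).1 h1⟩

theorem SkewLinExt.ascSet_toPath (hβα : Comp.Contained β α) (s : SkewLinExt α β) :
    (s.toPath hβα).ascSet = desSet (fun p : skewDiagram α β => cellLab p.1) s.1 := by
  ext d
  rw [s.mem_desSet_iff, Path.ascSet, Finset.mem_filter, Finset.mem_Icc]
  change (_ ∧ ∃ a b : Fin (skewDiagram α β).card, (b : ℕ) = a + 1 ∧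
    d + b = (skewDiagram α β).card ∧ (s.1.symm a.rev).1.1 ≤ (s.1.symm b.rev).1.1) ↔ _
  constructor
  · rintro ⟨-, a, b, h1, h2, h3⟩
    refine ⟨b.rev, a.rev, ?_, ?_, h3⟩ <;> simp only [Fin.val_rev] <;> omega
  · rintro ⟨a, b, h1, h2, h3⟩
    refine ⟨?_, b.rev, a.rev, ?_, ?_, ?_⟩
    · change 1 ≤ d ∧ d ≤ (skewDiagram α β).card - 1
      omega
    · simp only [Fin.val_rev]
      omega
    · simp only [Fin.val_rev]
      omega
    · rwa [Fin.rev_rev, Fin.rev_rev]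

theorem isFinSum_skewTableau (α β : Comp) :
    IsFinSum (fun T : SkewTableau α β => F (compOf (skewDiagram α β).card T.rsDes))
      (cellGen (skewDiagram α β) cellLab) := by
  have h1 := isFinSum_of_bijective
    (fun T : SkewTableau α β => F (compOf (skewDiagram α β).card T.rsDes))
    SkewLinExt.toTableau_bijective
  simp only [SkewLinExt.rsDes_toTableau] at h1
  rwa [cellGen_skewDiagram_eq_sum]

theorem isFinSum_path (hβα : Comp.Contained β α) :
    IsFinSum (fun P : Path α β => F (compOf P.length P.ascSet))
      (cellGen (skewDiagram α β) cellLab) := by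
  have h1 := isFinSum_of_bijective (fun P : Path α β => F (compOf P.length P.ascSet))
    ⟨SkewLinExt.toPath_injective hβα, SkewLinExt.toPath_surjective hβα⟩
  simp only [SkewLinExt.ascSet_toPath] at h1
  rwa [cellGen_skewDiagram_eq_sum]

end RowStrictImmaculate

theorem theorem4p6 (α β : Comp) (hβα : Comp.Contained β α) :
    -- the two families of immaculate functions are well defined by duality
    (∀ δ : Comp, ∃! g : NSym, IsDualTo dualImmaculate δ g) ∧
    (∀ δ : Comp, ∃! g : NSym, IsDualTo rsDualImmaculate δ g) ∧
    -- the sums that define the two skew functions are finite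
    IsFinSum (fun γ : Comp => pairing (immaculate β * h γ) (dualImmaculate α) • M γ)
      (skewDualImmaculate α β) ∧
    IsFinSum (fun γ : Comp => pairing (rsImmaculate β * h γ) (rsDualImmaculate α) • M γ)
      (skewRsDualImmaculate α β) ∧
    -- the expansions of the skew row-strict dual immaculate function
    IsFinSum (fun γ : Comp => pairing (rsImmaculate β * ribbon γ) (rsDualImmaculate α) • F γ)
      (skewRsDualImmaculate α β) ∧
    skewRsDualImmaculate α β = psi (skewDualImmaculate α β) ∧
    IsFinSum (fun γ : Comp =>
        pairing (rsImmaculate β * rsImmaculate γ) (rsDualImmaculate α) • rsDualImmaculate γ)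
      (skewRsDualImmaculate α β) ∧
    IsFinSum (fun P : Path α β => F (compOf P.length P.ascSet)) (skewRsDualImmaculate α β) ∧
    IsFinSum (fun T : SkewTableau α β => F (compOf (skewDiagram α β).card T.rsDes))
      (skewRsDualImmaculate α β) := by
  refine ⟨existsUnique_isDualTo (fun _ _ => coeffAt_dualImmaculate_of_size_ne)
      linearIndependent_dualImmaculate,
    existsUnique_isDualTo (fun _ _ => coeffAt_rsDualImmaculate_of_size_ne)
      linearIndependent_rsDualImmaculate, ?_⟩
  rw [skewDualImmaculate_eq hβα, skewRsDualImmaculate_eq hβα]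
  simp only [pairing_immaculate_mul hβα, pairing_rsImmaculate_mul hβα]
  exact ⟨isFinSum_of_isDualTo span_M isDualTo_M_h _, isFinSum_of_isDualTo span_M isDualTo_M_h _,
    isFinSum_of_isDualTo F_span isDualTo_F_ribbon _, (psi_cellGen _).symm,
    isFinSum_of_isDualTo (span_of_homogeneous (fun _ _ => coeffAt_rsDualImmaculate_of_size_ne)
      linearIndependent_rsDualImmaculate) isDualTo_rsImmaculate _,
    isFinSum_path hβα, isFinSum_skewTableau α β⟩
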